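/- Let $p$ be a prime, let $K\subset \mathbf{C}_p$ be a finite extension of $\mathbf{Q}_p$ with ring of integers $\mathcal{O}_K$ and maximal ideal $\mathfrak{m}_K$ (and similarly for other subfields of $\mathbf{C}_p$). A series $g\in X\cdot\mathcal{O}_K[[X]]$ is called invertible if $g'(0)\in\mathcal{O}_K^\times$, noninvertible if $g'(0)\in\mathfrak{m}_K$, and stable if $g'(0)$ is neither $0$ nor a root of unity. Let $g^{\circ n}$ denote the $n$-th iterate of $g$ under composition. Let $\mathrm{U}_g$ be the set of invertible series $u\in X\cdot\mathcal{O}_K[[X]]$ with $g\circ u=u\circ g$, and let $\mathrm{U}_g'(0)=\{u'(0) : u\in \mathrm{U}_g\}$. Roots of a power series are its roots in the open unit disk $\mathfrak{m}_{\mathbf{C}_p}$ of $\mathbf{C}_p$, counted with their usual multiplicity. Let $f\in X\cdot\mathcal{O}_K[[X]]$ be a noninvertible stable series with $f\not\equiv 0 \bmod \mathfrak{m}_K$, let $m\geq 2$ be an integer, and let $h(X)=X^m$. Suppose that, for all $n\geq 1$, all nonzero roots of $f^{\circ n}$ have multiplicity $m$. Suppose moreover that $f$ commutes with some stable invertible series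 in $X\cdot\mathcal{O}_K[[X]]$, or that $p\nmid m$. Then there exist a finite unramified extension $L\subset\mathbf{C}_p$ of $K$ and a noninvertible stable series $f_0\in X\cdot\mathcal{O}_L[[X]]$ with $f_0\not\equiv 0\bmod \mathfrak{m}_L$ such that the following hold. 1. $f\circ h=h\circ f_0$, that is, $f(X^m)=f_0(X)^m$, and for all $n\geq 1$ the roots of $f_0^{\circ n}$ are simple. 2. For every $u\in \mathrm{U}_f$ with $u'(0)\equiv 1\bmod \mathfrak{m}_K$ there exists $u_0\in \mathrm{U}_{f_0}$ (the invertible series in $X\cdot\mathcal{O}_L[[X]]$ commuting with $f_0$) such that $u\circ h=h\circ u_0$. 3. For every subfield $F$ of $K$ such that $f'(0)\in\mathfrak{m}_F$ and such that $\mathrm{U}_f'(0)\cap\mathcal{O}_F^\times$ is an open subgroup of $\mathcal{O}_F^\times$, one has $(f_0^{\circ m})'(0)\in\mathfrak{m}_F$, and $\mathrm{U}_{f_0}'(0)\cap\mathcal{O}_F^\times$ is an open subgroup of $\mathcal{O}_F^\times$. -/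

import Mathlib

open PowerSeries IsLocalRing

/-! ### Rings of integers of subfields of the `p`-adic complex numbers -/

/-- The ring of integers `{x ∈ k : |x|_p ≤ 1}` of a field `k` embedded in `ℂ_[p]`. -/
noncomputable def RingInt (p : ℕ) [Fact p.Prime] (k : Type*) [Field k] [Algebra k ℂ_[p]] :
    ValuationSubring k :=
  (𝓞_ℂ_[p]).comap (algebraMap k ℂ_[p])

theorem mem_RingInt_iff {p : ℕ} [Fact p.Prime] {k : Type*} [Field k] [Algebra k ℂ_[p]] (x : k) :
    x ∈ RingInt p k ↔ algebraMap k ℂ_[p] x ∈ 𝓞_ℂ_[p] := Iff.rfl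

/-- The inclusion of rings of integers induced by an extension `k → l` inside `ℂ_[p]`. -/
noncomputable def RingInt.incl (p : ℕ) [Fact p.Prime] (k l : Type*) [Field k] [Field l]
    [Algebra k ℂ_[p]] [Algebra l ℂ_[p]] [Algebra k l] [IsScalarTower k l ℂ_[p]] :
    RingInt p k →+* RingInt p l :=
  ((algebraMap k l).comp (RingInt p k).subtype).codRestrict (RingInt p l) fun x => by
    rw [mem_RingInt_iff, RingHom.comp_apply, ← IsScalarTower.algebraMap_apply]
    exact x.2

/-- The inclusion of the ring of integers of `k` in the ring of integers of `ℂ_[p]`. -/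
noncomputable def RingInt.toComplex (p : ℕ) [Fact p.Prime] (k : Type*) [Field k]
    [Algebra k ℂ_[p]] : RingInt p k →+* 𝓞_ℂ_[p] :=
  ((algebraMap k ℂ_[p]).comp (RingInt p k).subtype).codRestrict 𝓞_ℂ_[p] fun x => x.2

/-- The extension `l / k` is unramified: the maximal ideal of the ring of integers of `k` generates
the maximal ideal of the ring of integers of `l`, that is, the ramification index is one. (For
finite extensions of `ℚ_[p]` the residue fields are finite, so the residue extension is
separable.) -/
def IsUnramifiedExt (p : ℕ) [Fact p.Prime] (k l : Type*) [Field k] [Field l]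
    [Algebra k ℂ_[p]] [Algebra l ℂ_[p]] [Algebra k l] [IsScalarTower k l ℂ_[p]] : Prop :=
  (maximalIdeal (RingInt p k)).map (RingInt.incl p k l) = maximalIdeal (RingInt p l)

/-! ### Formal power series under composition -/

section Series

variable {R : Type*} [CommRing R]

/-- The composition `f ∘ g = f(g(X))`; it is meaningful when `g` has no constant term. -/
noncomputable def PowerSeries.compose (f g : R⟦X⟧) : R⟦X⟧ := PowerSeries.subst g f

/-- The iterate `f^{∘ n}`. -/
noncomputable def PowerSeries.compIter (f : R⟦X⟧) : ℕ → R⟦X⟧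
  | 0 => X
  | n + 1 => f.compose (f.compIter n)

/-- `f'(0)`. -/
noncomputable def PowerSeries.derivZero (f : R⟦X⟧) : R := coeff 1 f

/-- `f ∈ X · R⟦X⟧` is stable: `f'(0)` is neither `0` nor a root of unity. -/
def PowerSeries.IsStable (f : R⟦X⟧) : Prop :=
  f.derivZero ≠ 0 ∧ ∀ n : ℕ, 1 ≤ n → f.derivZero ^ n ≠ 1

/-- The set `U_f` of the invertible series `u ∈ X · R⟦X⟧` that commute with `f`. -/
def PowerSeries.commInvertible (f : R⟦X⟧) : Set R⟦X⟧ :=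
  {u | constantCoeff u = 0 ∧ IsUnit u.derivZero ∧ f.compose u = u.compose f}

/-- For a local ring `R`, the series `f ∈ X · R⟦X⟧` is noninvertible and stable, and `f` is
nonzero modulo the maximal ideal of `R`. -/
structure PowerSeries.IsNoninvertibleStable [IsLocalRing R] (f : R⟦X⟧) : Prop where
  constantCoeff_eq_zero : constantCoeff f = 0
  noninvertible : f.derivZero ∈ maximalIdeal R
  stable : f.IsStable
  map_residue_ne_zero : f.map (residue R) ≠ 0

end Series

/-! ### Roots in the open unit disk and their multiplicities -/

section Roots

variable {p : ℕ} [Fact p.Prime] {k : Type*} [Field k] [Algebra k ℂ_[p]]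

/-- The value at a point `z` of the open unit disk of `ℂ_[p]` of a series with integral
coefficients. The sum converges. -/
noncomputable def evalDisk (g : (RingInt p k)⟦X⟧) (z : maximalIdeal 𝓞_ℂ_[p]) : ℂ_[p] :=
  ∑' i : ℕ, (RingInt.toComplex p k (coeff i g) : ℂ_[p]) * ((z : 𝓞_ℂ_[p]) : ℂ_[p]) ^ i

/-- The multiplicity of `z` as a root of `g`: the largest `e` such that `(X - z) ^ e` divides `g`
in the ring of power series with coefficients in the ring of integers of `ℂ_[p]`. -/
noncomputable def rootMult (g : (RingInt p k)⟦X⟧) (z : maximalIdeal 𝓞_ℂ_[p]) : ℕ∞ :=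
  emultiplicity (X - C (z : 𝓞_ℂ_[p])) (g.map (RingInt.toComplex p k))

/-- The nonzero roots of `g` in the open unit disk have multiplicity `m`. -/
def NonzeroRootsHaveMult (g : (RingInt p k)⟦X⟧) (m : ℕ) : Prop :=
  ∀ z : maximalIdeal 𝓞_ℂ_[p], z ≠ 0 → evalDisk g z = 0 → rootMult g z = m

/-- The roots of `g` in the open unit disk are simple. -/
def RootsAreSimple (g : (RingInt p k)⟦X⟧) : Prop :=
  ∀ z : maximalIdeal 𝓞_ℂ_[p], evalDisk g z = 0 → rootMult g z = 1

end Roots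

/-- For fields `F → k` inside `ℂ_[p]` and a series `f` over the ring of integers of `k`, the set
`U_f'(0) ∩ O_F^×` is an open subgroup of the group `O_F^×` (with its `p`-adic topology). -/
def IsOpenSubgroupDerivs {p : ℕ} [Fact p.Prime] {k : Type*} (F : Type*) [Field k] [Field F]
    [TopologicalSpace F] [Algebra k ℂ_[p]] [Algebra F ℂ_[p]] [Algebra F k]
    [IsScalarTower F k ℂ_[p]] (f : (RingInt p k)⟦X⟧) : Prop :=
  ∃ H : Subgroup (RingInt p F)ˣ, IsOpen (H : Set (RingInt p F)ˣ) ∧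
    ∀ a : (RingInt p F)ˣ,
      a ∈ H ↔ ∃ u ∈ f.commInvertible, u.derivZero = RingInt.incl p F k a

/-! Factorization. Write `f = X * g` and apply Weierstrass preparation to `g`, getting a
distinguished polynomial `G` times a unit. In characteristic zero an irreducible factor of `G` is
separable, so its exponent in `G` is the multiplicity of each of its roots. These roots are nonzero
because `f'(0) ≠ 0`, so every exponent is `m`, and `f = X * P ^ m * v` with `v` a unit
(`exists_eq_X_mul_pow_mul_unit`).

Semiconjugacy when `p ∤ m`. A finite unramified extension contains an `m`-th root of `v(0)`, and
`X`-adic Hensel then gives `v = w ^ m`. Hence `f(X ^ m) = f₀ ^ m` with `f₀ = X * (P * w)(X ^ m)`. A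
series `u` commuting with `f` lifts in the same way once an `m`-th root of `u'(0)` is chosen. The
lift commutes with `f₀` because an `m`-th root of a series is determined by its nonzero linear
coefficient (`exists_commInvertible_lift`). Simplicity of roots comes from comparing multiplicities
at `z` and `z ^ m`.

Why a commuting stable `u` forces `p ∤ m` (`not_dvd_of_commInvertible_stable`). If `p ∣ m`, then `f'
= P ^ (m - 1) * Q`, where `Q` is congruent to `P` times a unit, so `Q` has a root `z` in the disk,
and `f(z) ≠ 0`. Now `u` preserves the finite set of critical points of `f`, so some point of the
`u`-orbit of `z` is fixed by an iterate of `u`. Its images under the iterates of `f` are also fixed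
and tend to `0`, while the stability of `u` isolates the fixed point `0`. So some iterate of `f`
kills `z`. As `z` is critical but not a root of `f`, its multiplicity there is at least `2 * m`, a
contradiction. -/

/-! ### Composition of formal power series and `m`-th roots -/

section Series

variable {R S : Type*} [CommRing R] [CommRing S]

namespace PowerSeries

theorem compose_add {g : R⟦X⟧} (hg : constantCoeff g = 0) (a b : R⟦X⟧) :
    (a + b).compose g = a.compose g + b.compose g :=
  subst_add (.of_constantCoeff_zero' hg) a b

theorem compose_sub {g : R⟦X⟧} (hg : constantCoeff g = 0) (a b : R⟦X⟧) :
    (a - b).compose g = a.compose g - b.compose g :=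
  subst_sub (.of_constantCoeff_zero' hg) a b

theorem compose_mul {g : R⟦X⟧} (hg : constantCoeff g = 0) (a b : R⟦X⟧) :
    (a * b).compose g = a.compose g * b.compose g :=
  subst_mul (.of_constantCoeff_zero' hg) a b

theorem compose_pow {g : R⟦X⟧} (hg : constantCoeff g = 0) (a : R⟦X⟧) (n : ℕ) :
    (a ^ n).compose g = a.compose g ^ n :=
  subst_pow (.of_constantCoeff_zero' hg) a n

theorem X_compose {g : R⟦X⟧} (hg : constantCoeff g = 0) : (X : R⟦X⟧).compose g = g :=
  subst_X (.of_constantCoeff_zero' hg)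

theorem X_pow_compose {g : R⟦X⟧} (hg : constantCoeff g = 0) (m : ℕ) :
    (X ^ m : R⟦X⟧).compose g = g ^ m := by
  rw [compose_pow hg, X_compose hg]

theorem compose_X (f : R⟦X⟧) : f.compose X = f := X_subst f

theorem C_compose (r : R) (g : R⟦X⟧) : (C r).compose g = C r := subst_C r

theorem compose_assoc {g h : R⟦X⟧} (hg : constantCoeff g = 0) (hh : constantCoeff h = 0)
    (f : R⟦X⟧) : (f.compose g).compose h = f.compose (g.compose h) :=
  subst_comp_subst_apply (.of_constantCoeff_zero' hg) (.of_constantCoeff_zero' hh) f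

theorem map_compose {g : R⟦X⟧} (hg : constantCoeff g = 0) (φ : R →+* S) (f : R⟦X⟧) :
    (f.compose g).map φ = (f.map φ).compose (g.map φ) :=
  map_subst (.of_constantCoeff_zero' hg) f

theorem eq_C_add_X_mul (f : R⟦X⟧) : ∃ q : R⟦X⟧, f = C (constantCoeff f) + X * q := by
  obtain ⟨q, hq⟩ := X_dvd_iff.2 (show constantCoeff (f - C (constantCoeff f)) = 0 by simp)
  exact ⟨q, by rw [← hq]; ring⟩

theorem eq_X_mul {f : R⟦X⟧} (hf : constantCoeff f = 0) :
    ∃ q : R⟦X⟧, f = X * q ∧ constantCoeff q = f.derivZero := by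
  obtain ⟨q, rfl⟩ := X_dvd_iff.2 hf
  exact ⟨q, rfl, by simp [derivZero]⟩

theorem constantCoeff_compose {g : R⟦X⟧} (hg : constantCoeff g = 0) (f : R⟦X⟧) :
    constantCoeff (f.compose g) = constantCoeff f := by
  obtain ⟨q, hq⟩ := eq_C_add_X_mul f
  rw [hq, compose_add hg, C_compose, compose_mul hg, X_compose hg]
  simp [hg]

theorem derivZero_X_mul (q : R⟦X⟧) : (X * q).derivZero = constantCoeff q := by
  simp [derivZero]

theorem derivZero_mul_of_constantCoeff_eq_zero {g : R⟦X⟧} (hg : constantCoeff g = 0) (q : R⟦X⟧) :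
    (g * q).derivZero = g.derivZero * constantCoeff q := by
  obtain ⟨r, rfl, hr⟩ := eq_X_mul hg
  rw [mul_assoc, derivZero_X_mul, derivZero_X_mul, map_mul]

theorem derivZero_compose {f g : R⟦X⟧} (hf : constantCoeff f = 0) (hg : constantCoeff g = 0) :
    (f.compose g).derivZero = f.derivZero * g.derivZero := by
  obtain ⟨q, rfl, hq⟩ := eq_X_mul hf
  rw [compose_mul hg, X_compose hg, derivZero_mul_of_constantCoeff_eq_zero hg,
    constantCoeff_compose hg, hq, mul_comm]

theorem derivZero_map (φ : R →+* S) (f : R⟦X⟧) : (f.map φ).derivZero = φ f.derivZero := by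
  simp [derivZero]

theorem constantCoeff_map_apply (φ : R →+* S) (f : R⟦X⟧) :
    constantCoeff (f.map φ) = φ (constantCoeff f) := by
  rw [← coeff_zero_eq_constantCoeff_apply, coeff_map, coeff_zero_eq_constantCoeff_apply]

theorem constantCoeff_derivative (f : R⟦X⟧) : constantCoeff (derivative R f) = f.derivZero := by
  rw [← coeff_zero_eq_constantCoeff_apply, coeff_derivative]
  simp [derivZero]

theorem derivZero_X : (X : R⟦X⟧).derivZero = 1 := by simp [derivZero]

theorem constantCoeff_compIter {f : R⟦X⟧} (hf : constantCoeff f = 0) (n : ℕ) :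
    constantCoeff (f.compIter n) = 0 := by
  induction n with
  | zero => simp [compIter]
  | succ n ih => rw [compIter, constantCoeff_compose ih, hf]

theorem derivZero_compIter {f : R⟦X⟧} (hf : constantCoeff f = 0) (n : ℕ) :
    (f.compIter n).derivZero = f.derivZero ^ n := by
  induction n with
  | zero => simp [compIter, derivZero_X]
  | succ n ih => rw [compIter, derivZero_compose hf (constantCoeff_compIter hf n), ih, pow_succ']

theorem map_compIter {f : R⟦X⟧} (hf : constantCoeff f = 0) (φ : R →+* S) (n : ℕ) :
    (f.compIter n).map φ = (f.map φ).compIter n := by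
  induction n with
  | zero => simp [compIter]
  | succ n ih => rw [compIter, compIter, map_compose (constantCoeff_compIter hf n), ih]

theorem compIter_compose {f g h : R⟦X⟧} (hf : constantCoeff f = 0) (hg : constantCoeff g = 0)
    (hh : constantCoeff h = 0) (H : f.compose h = h.compose g) (n : ℕ) :
    (f.compIter n).compose h = h.compose (g.compIter n) := by
  induction n with
  | zero => rw [compIter, compIter, X_compose hh, compose_X]
  | succ n ih =>
    have hfn := constantCoeff_compIter hf n
    have hgn := constantCoeff_compIter hg n
    rw [compIter, compIter, compose_assoc hfn hh, ih, ← compose_assoc hh hgn, H,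
      compose_assoc hg hgn]

/-- Over a domain, two series with the same `m`-th power and the same nonzero linear coefficient
are equal. -/
theorem eq_of_pow_eq_pow [IsDomain R] {a b : R⟦X⟧} {m : ℕ} (hm : (m : R) ≠ 0)
    (ha : constantCoeff a = 0) (hb : constantCoeff b = 0) (hab : a.derivZero = b.derivZero)
    (h0 : a.derivZero ≠ 0) (h : a ^ m = b ^ m) : a = b := by
  obtain ⟨q, rfl, hq⟩ := eq_X_mul ha
  obtain ⟨r, rfl, hr⟩ := eq_X_mul hb
  have hqr : q ^ m = r ^ m := by
    rw [mul_pow, mul_pow] at h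
    exact mul_left_cancel₀ (pow_ne_zero m X_ne_zero) h
  have h1 := Commute.geom_sum₂_mul (Commute.all q r) m
  rw [hqr, sub_self] at h1
  rcases mul_eq_zero.1 h1 with h2 | h2
  -- The geometric sum has constant coefficient `m * a'(0) ^ (m - 1)`, which is nonzero, so it
  -- cannot be the vanishing factor.
  · exfalso
    have h3 := congrArg constantCoeff h2
    rw [map_sum, map_zero] at h3
    simp only [map_mul, map_pow, hq, hr, ← hab, ← pow_add] at h3
    rw [Finset.sum_congr rfl (g := fun _ => (X * q).derivZero ^ (m - 1))
      (fun i hi => by congr 1; have := Finset.mem_range.1 hi; omega)] at h3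
    rw [Finset.sum_const, Finset.card_range, nsmul_eq_mul] at h3
    exact mul_ne_zero hm (pow_ne_zero _ h0) h3
  · rw [sub_eq_zero.1 h2]

/-- Hensel's lemma for the `X`-adic topology applied to `Y ^ m - t`, with approximate root `C c`:
the derivative there is `m * c ^ (m - 1)`, a unit. -/
theorem exists_pow_eq {m : ℕ} (hm0 : m ≠ 0) (hm : IsUnit (m : R)) {t : R⟦X⟧} {c : R}
    (hc : IsUnit c) (h : c ^ m = constantCoeff t) :
    ∃ s : R⟦X⟧, s ^ m = t ∧ constantCoeff s = c := by
  have hmem (g : R⟦X⟧) : g ∈ Ideal.span {(X : R⟦X⟧)} ↔ constantCoeff g = 0 := by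
    rw [Ideal.mem_span_singleton, X_dvd_iff]
  have hunit : IsUnit ((m : R⟦X⟧) * C c ^ (m - 1)) := by
    rw [isUnit_iff_constantCoeff]
    simpa using hm.mul (hc.pow (m - 1))
  obtain ⟨s, hs, hs'⟩ := HenselianRing.is_henselian (I := Ideal.span {(X : R⟦X⟧)})
    (Polynomial.X ^ m - Polynomial.C t) (Polynomial.monic_X_pow_sub_C t hm0) (C c)
    (by rw [hmem]; simp [h])
    (by
      have : Polynomial.eval (C c) (Polynomial.derivative (Polynomial.X ^ m - Polynomial.C t)) =
          (m : R⟦X⟧) * C c ^ (m - 1) := by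
        simp [Polynomial.derivative_X_pow]
      rw [this]
      exact hunit.map _)
  refine ⟨s, ?_, ?_⟩
  · simpa [Polynomial.IsRoot, sub_eq_zero] using hs
  · rw [hmem] at hs'
    simpa [sub_eq_zero] using hs'

theorem commInvertible_compose {f u v : R⟦X⟧} (hf : constantCoeff f = 0)
    (hu : u ∈ f.commInvertible) (hv : v ∈ f.commInvertible) : u.compose v ∈ f.commInvertible := by
  obtain ⟨hu0, hu1, hu2⟩ := hu
  obtain ⟨hv0, hv1, hv2⟩ := hv
  refine ⟨by rw [constantCoeff_compose hv0, hu0], ?_, ?_⟩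
  · rw [derivZero_compose hu0 hv0]; exact hu1.mul hv1
  · rw [← compose_assoc hu0 hv0, hu2, compose_assoc hf hv0, hv2, compose_assoc hv0 hf]

theorem X_mem_commInvertible {f : R⟦X⟧} (hf : constantCoeff f = 0) : X ∈ f.commInvertible :=
  ⟨by simp, by simp [derivZero_X], by rw [compose_X, X_compose hf]⟩

theorem exists_compose_inverse {u : R⟦X⟧} (hu : constantCoeff u = 0) (hu1 : IsUnit u.derivZero) :
    ∃ v : R⟦X⟧, constantCoeff v = 0 ∧ u.compose v = X ∧ v.compose u = X :=
  ⟨u.substInvOfIsUnit hu1, constantCoeff_substInvOfIsUnit u hu1,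
    subst_substInvOfIsUnit_right u hu hu1, subst_substInvOfIsUnit_left u hu hu1⟩

theorem exists_inverse_mem_commInvertible {f u : R⟦X⟧} (hf : constantCoeff f = 0)
    (hu : u ∈ f.commInvertible) :
    ∃ v ∈ f.commInvertible, u.derivZero * v.derivZero = 1 := by
  obtain ⟨hu0, hu1, hu2⟩ := hu
  obtain ⟨v, hv0, huv, hvu⟩ := exists_compose_inverse hu0 hu1
  have h1 : u.derivZero * v.derivZero = 1 := by
    rw [← derivZero_compose hu0 hv0, huv, derivZero_X]
  refine ⟨v, ⟨hv0, .of_mul_eq_one _ (by rw [mul_comm]; exact h1), ?_⟩, h1⟩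
  have hfv : constantCoeff (f.compose v) = 0 := by rw [constantCoeff_compose hv0, hf]
  calc f.compose v = (v.compose u).compose (f.compose v) := by rw [hvu, X_compose hfv]
    _ = v.compose ((u.compose f).compose v) := by
      rw [compose_assoc hu0 hfv, compose_assoc hf hv0]
    _ = v.compose f := by
      rw [← hu2, compose_assoc hu0 hv0, huv, compose_X]

/-- Lifting along `X ^ m` of a series commuting with `f`. -/
theorem exists_commInvertible_lift [IsDomain R] {f f₀ u : R⟦X⟧} {m : ℕ} (hm0 : m ≠ 0)
    (hm : IsUnit (m : R)) (hf : constantCoeff f = 0) (hf₀ : constantCoeff f₀ = 0)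
    (hd : f₀.derivZero ≠ 0) (hff₀ : f.compose (X ^ m) = f₀ ^ m)
    (hu : u ∈ f.commInvertible) {c : R} (hc : c ^ m = u.derivZero) :
    ∃ u₀ ∈ f₀.commInvertible, u.compose (X ^ m) = u₀ ^ m ∧ u₀.derivZero = c := by
  obtain ⟨hu0, hu1, hu2⟩ := hu
  have hcu : IsUnit c := (isUnit_pow_iff hm0).1 (hc ▸ hu1)
  have hXm : constantCoeff (X ^ m : R⟦X⟧) = 0 := by simp [hm0]
  obtain ⟨q, hq, hq0⟩ := eq_X_mul hu0
  obtain ⟨s, hs, hs0⟩ := exists_pow_eq hm0 hm (t := q) hcu (by rw [hc, hq0])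
  have hw0 : constantCoeff (X * s.compose (X ^ m)) = 0 := by simp
  have hw1 : (X * s.compose (X ^ m)).derivZero = c := by
    rw [derivZero_X_mul, constantCoeff_compose hXm, hs0]
  have hw : u.compose (X ^ m) = (X * s.compose (X ^ m)) ^ m := by
    rw [hq, compose_mul hXm, X_compose hXm, ← hs, compose_pow hXm, mul_pow]
  generalize X * s.compose (X ^ m) = w at *
  refine ⟨w, ⟨hw0, hw1 ▸ hcu, ?_⟩, hw, hw1⟩
  have hm' : (m : R) ≠ 0 := hm.ne_zero
  -- `f₀ ∘ w` and `w ∘ f₀` have the same linear coefficient, and their `m`-th powers are `f ∘ u ∘ X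
  -- ^ m` and `u ∘ f ∘ X ^ m`.
  refine eq_of_pow_eq_pow hm' (by rw [constantCoeff_compose hw0, hf₀])
    (by rw [constantCoeff_compose hf₀, hw0])
    (by rw [derivZero_compose hf₀ hw0, derivZero_compose hw0 hf₀, mul_comm])
    (by rw [derivZero_compose hf₀ hw0, hw1]; exact mul_ne_zero hd hcu.ne_zero) ?_
  calc f₀.compose w ^ m = (f₀ ^ m).compose w := (compose_pow hw0 _ _).symm
    _ = f.compose (w ^ m) := by rw [← hff₀, compose_assoc hXm hw0, X_pow_compose hw0]
    _ = (f.compose u).compose (X ^ m) := by rw [← hw, compose_assoc hu0 hXm]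
    _ = u.compose (f₀ ^ m) := by rw [hu2, compose_assoc hf hXm, hff₀]
    _ = (w ^ m).compose f₀ := by rw [← hw, compose_assoc hXm hf₀, X_pow_compose hf₀]
    _ = w.compose f₀ ^ m := compose_pow hf₀ _ _

end PowerSeries

end Series

/-! ### Rings of integers: norms, uniformizers, completeness -/

section Integers

variable {p : ℕ} [Fact p.Prime]

theorem PadicComplexInt.mem_iff_norm_le_one (x : ℂ_[p]) : x ∈ 𝓞_ℂ_[p] ↔ ‖x‖ ≤ 1 := by
  rw [PadicComplex.norm_eq_norm]
  refine Iff.trans ?_ Valued.toNormedField.norm_le_one_iff.symm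
  exact Iff.rfl

theorem PadicComplexInt.isUnit_iff_norm_eq_one (x : 𝓞_ℂ_[p]) : IsUnit x ↔ ‖(x : ℂ_[p])‖ = 1 := by
  have hx : ‖(x : ℂ_[p])‖ ≤ 1 := (mem_iff_norm_le_one _).1 x.2
  constructor
  · rintro ⟨u, rfl⟩
    have h1 : ‖((u⁻¹ : (𝓞_ℂ_[p])ˣ) : 𝓞_ℂ_[p]).1‖ ≤ 1 := (mem_iff_norm_le_one _).1 (Subtype.prop _)
    have h2 : ‖(u : 𝓞_ℂ_[p]).1‖ * ‖((u⁻¹ : (𝓞_ℂ_[p])ˣ) : 𝓞_ℂ_[p]).1‖ = 1 := by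
      rw [← norm_mul, ← MulMemClass.coe_mul, Units.mul_inv]; simp
    nlinarith [norm_nonneg (u : 𝓞_ℂ_[p]).1]
  · intro h
    have h0 : (x : ℂ_[p]) ≠ 0 := by rw [← norm_ne_zero_iff, h]; exact one_ne_zero
    refine .of_mul_eq_one ⟨(x : ℂ_[p])⁻¹, (mem_iff_norm_le_one _).2 (by simp [h])⟩ ?_
    exact Subtype.ext (mul_inv_cancel₀ h0)

theorem PadicComplexInt.mem_maximalIdeal_iff (x : 𝓞_ℂ_[p]) :
    x ∈ maximalIdeal 𝓞_ℂ_[p] ↔ ‖(x : ℂ_[p])‖ < 1 := by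
  rw [mem_maximalIdeal, mem_nonunits_iff, isUnit_iff_norm_eq_one,
    lt_iff_le_and_ne, and_iff_right ((mem_iff_norm_le_one _).1 x.2)]

variable {k : Type*} [Field k] [Algebra k ℂ_[p]]

namespace RingInt

theorem coe_toComplex (x : RingInt p k) : (toComplex p k x : ℂ_[p]) = algebraMap k ℂ_[p] x := rfl

theorem toComplex_injective : Function.Injective (toComplex p k) := fun _ _ h =>
  Subtype.ext ((algebraMap k ℂ_[p]).injective (congrArg Subtype.val h))

theorem norm_le_one (x : RingInt p k) : ‖algebraMap k ℂ_[p] x‖ ≤ 1 :=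
  (PadicComplexInt.mem_iff_norm_le_one _).1 x.2

theorem mem_iff_norm_le_one (x : k) : x ∈ RingInt p k ↔ ‖algebraMap k ℂ_[p] x‖ ≤ 1 :=
  PadicComplexInt.mem_iff_norm_le_one _

theorem dvd_iff_norm_le (x y : RingInt p k) :
    x ∣ y ↔ ‖algebraMap k ℂ_[p] y‖ ≤ ‖algebraMap k ℂ_[p] x‖ := by
  constructor
  · rintro ⟨z, rfl⟩
    rw [MulMemClass.coe_mul, map_mul, norm_mul]
    exact mul_le_of_le_one_right (norm_nonneg _) (norm_le_one z)
  · intro h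
    by_cases hx : x = 0
    · subst hx
      have : y = 0 := by
        refine Subtype.ext ((algebraMap k ℂ_[p]).injective ?_)
        simpa using h
      rw [this]
    have hx' : (x : k) ≠ 0 := fun h0 => hx (Subtype.ext h0)
    refine ⟨⟨(y : k) / x, (mem_iff_norm_le_one _).2 ?_⟩, Subtype.ext ?_⟩
    · rw [map_div₀, norm_div]
      exact div_le_one_of_le₀ h (norm_nonneg _)
    · rw [MulMemClass.coe_mul]
      exact (mul_div_cancel₀ _ hx').symm

theorem isUnit_iff_norm_eq_one (x : RingInt p k) : IsUnit x ↔ ‖algebraMap k ℂ_[p] x‖ = 1 := by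
  rw [isUnit_iff_dvd_one, dvd_iff_norm_le]
  simpa using (norm_le_one x).ge_iff_eq

theorem mem_maximalIdeal_iff (x : RingInt p k) :
    x ∈ maximalIdeal (RingInt p k) ↔ ‖algebraMap k ℂ_[p] x‖ < 1 := by
  rw [mem_maximalIdeal, mem_nonunits_iff, isUnit_iff_norm_eq_one, (norm_le_one x).lt_iff_ne]

theorem toComplex_mem_maximalIdeal_iff (x : RingInt p k) :
    toComplex p k x ∈ maximalIdeal 𝓞_ℂ_[p] ↔ x ∈ maximalIdeal (RingInt p k) := by
  rw [mem_maximalIdeal_iff, PadicComplexInt.mem_maximalIdeal_iff, coe_toComplex]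

theorem norm_natCast_eq_one {m : ℕ} (hm : ¬ p ∣ m) : ‖(m : ℂ_[p])‖ = 1 := by
  rw [← map_natCast (algebraMap ℚ_[p] ℂ_[p]), norm_algebraMap', Padic.norm_natCast_eq_one_iff]
  exact ((Fact.out : p.Prime).coprime_iff_not_dvd.2 hm)

theorem isUnit_natCast {m : ℕ} (hm : ¬ p ∣ m) : IsUnit (m : RingInt p k) := by
  rw [isUnit_iff_norm_eq_one]
  simpa using norm_natCast_eq_one hm

theorem natCast_mem_maximalIdeal {m : ℕ} (hm : p ∣ m) :
    (m : RingInt p k) ∈ maximalIdeal (RingInt p k) := by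
  obtain ⟨n, rfl⟩ := hm
  rw [Nat.cast_mul]
  refine Ideal.mul_mem_right _ _ ((mem_maximalIdeal_iff _).2 ?_)
  have : ‖(p : ℂ_[p])‖ < 1 := by
    rw [← map_natCast (algebraMap ℚ_[p] ℂ_[p]), norm_algebraMap']
    exact Padic.norm_p_lt_one
  simpa using this

section Incl

variable {l : Type*} [Field l] [Algebra l ℂ_[p]] [Algebra k l] [IsScalarTower k l ℂ_[p]]

theorem algebraMap_incl (x : RingInt p k) :
    algebraMap l ℂ_[p] (incl p k l x) = algebraMap k ℂ_[p] x :=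
  (IsScalarTower.algebraMap_apply k l ℂ_[p] (x : k)).symm

theorem toComplex_comp_incl : (toComplex p l).comp (incl p k l) = toComplex p k :=
  RingHom.ext fun x => Subtype.ext (algebraMap_incl x)

theorem incl_injective : Function.Injective (incl p k l) := fun _ _ h =>
  Subtype.ext ((algebraMap k l).injective (congrArg Subtype.val h))

theorem incl_mem_maximalIdeal_iff (x : RingInt p k) :
    incl p k l x ∈ maximalIdeal (RingInt p l) ↔ x ∈ maximalIdeal (RingInt p k) := by
  rw [mem_maximalIdeal_iff, mem_maximalIdeal_iff, algebraMap_incl]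

theorem incl_incl {l' : Type*} [Field l'] [Algebra l' ℂ_[p]] [Algebra l l'] [Algebra k l']
    [IsScalarTower l l' ℂ_[p]] [IsScalarTower k l' ℂ_[p]] (x : RingInt p k) :
    incl p l l' (incl p k l x) = incl p k l' x :=
  Subtype.ext ((algebraMap l' ℂ_[p]).injective (by simp only [algebraMap_incl]))

end Incl

section FiniteDimensional

variable [Algebra ℚ_[p] k] [IsScalarTower ℚ_[p] k ℂ_[p]] [FiniteDimensional ℚ_[p] k]

variable (p k) in
-- A finite-dimensional subspace over the locally compact field `ℚ_[p]` is proper. This compactness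
-- yields both the discreteness and the completeness of the ring of integers.
theorem isCompact_range_inter_closedBall :
    IsCompact (Set.range (algebraMap k ℂ_[p]) ∩ Metric.closedBall 0 1) := by
  set V : Submodule ℚ_[p] ℂ_[p] := (IsScalarTower.toAlgHom ℚ_[p] k ℂ_[p]).toLinearMap.range
  have : ProperSpace V := FiniteDimensional.proper ℚ_[p] V
  convert (isCompact_closedBall (0 : V) 1).image continuous_subtype_val using 1
  ext x
  simp only [Set.mem_inter_iff, Set.mem_range, Metric.mem_closedBall, dist_zero_right,
    Set.mem_image, Subtype.exists, exists_and_right, exists_eq_right]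
  constructor
  · rintro ⟨⟨y, rfl⟩, h⟩
    exact ⟨⟨y, rfl⟩, h⟩
  · rintro ⟨⟨y, rfl⟩, h⟩
    exact ⟨⟨y, rfl⟩, h⟩

variable (p k) in
-- In an ultrametric space the open unit ball is closed, so the norm attains its maximum on the
-- compact set of elements of norm less than one; the maximum is positive because `p` lies in that
-- set.
theorem exists_uniformizer : ∃ ϖ : RingInt p k, ϖ ≠ 0 ∧ ϖ ∈ maximalIdeal (RingInt p k) ∧
    ∀ x ∈ maximalIdeal (RingInt p k), ‖algebraMap k ℂ_[p] x‖ ≤ ‖algebraMap k ℂ_[p] ϖ‖ := by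
  have hc : IsCompact (Set.range (algebraMap k ℂ_[p]) ∩ Metric.closedBall 0 1 ∩
      Metric.ball 0 1) :=
    (isCompact_range_inter_closedBall p k).inter_right (IsUltrametricDist.isClosed_ball 0 1)
  obtain ⟨x, ⟨⟨⟨ϖ, rfl⟩, h1⟩, h2⟩, hmax⟩ := hc.exists_isMaxOn
    ⟨0, ⟨⟨0, map_zero _⟩, by simp⟩, by simp⟩ continuous_norm.continuousOn
  have hle (x : RingInt p k) (hx : x ∈ maximalIdeal (RingInt p k)) :
      ‖algebraMap k ℂ_[p] x‖ ≤ ‖algebraMap k ℂ_[p] ϖ‖ := by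
    rw [mem_maximalIdeal_iff] at hx
    exact hmax ⟨⟨⟨x, rfl⟩, by simpa using hx.le⟩, by simpa using hx⟩
  refine ⟨⟨ϖ, (mem_iff_norm_le_one _).2 (by simpa using h1)⟩, ?_,
    (mem_maximalIdeal_iff _).2 (by simpa using h2), hle⟩
  intro h
  have hϖ : ϖ = 0 := congrArg Subtype.val h
  have hp := hle _ (natCast_mem_maximalIdeal (k := k) (dvd_refl p))
  rw [hϖ, map_zero, norm_zero, norm_le_zero_iff] at hp
  have : (p : ℂ_[p]) = 0 := by simpa using hp
  exact (Fact.out : p.Prime).ne_zero (by exact_mod_cast this)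

instance : IsDiscreteValuationRing (RingInt p k) := by
  obtain ⟨ϖ, h0, hm, hmax⟩ := exists_uniformizer p k
  have hspan : maximalIdeal (RingInt p k) = Ideal.span {ϖ} := by
    refine le_antisymm (fun x hx => ?_) ((Ideal.span_singleton_le_iff_mem _).2 hm)
    rw [Ideal.mem_span_singleton, dvd_iff_norm_le]
    exact hmax x hx
  have hprime : Prime ϖ := by
    rw [← Ideal.span_singleton_prime h0, ← hspan]
    infer_instance
  refine IsDiscreteValuationRing.ofHasUnitMulPowIrreducibleFactorization
    ⟨ϖ, hprime.irreducible, fun {x} hx => ?_⟩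
  have hx0 : 0 < ‖algebraMap k ℂ_[p] x‖ := by
    rw [norm_pos_iff]
    simpa using hx
  have hϖ0 : 0 < ‖algebraMap k ℂ_[p] ϖ‖ := by
    rw [norm_pos_iff]
    simpa using h0
  -- Choose `n` with `‖ϖ‖ ^ (n + 1) < ‖x‖ ≤ ‖ϖ‖ ^ n`; the quotient `x / ϖ ^ n` is then too large to
  -- be a nonunit.
  obtain ⟨n, hn1, hn2⟩ := exists_nat_pow_near_of_lt_one hx0 (norm_le_one x) hϖ0
    ((mem_maximalIdeal_iff _).1 hm)
  obtain ⟨y, rfl⟩ : ϖ ^ n ∣ x := by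
    rw [dvd_iff_norm_le]
    simpa using hn2
  refine ⟨n, associated_mul_unit_right _ _ ?_⟩
  by_contra hy
  have hy' := hmax y ((mem_maximalIdeal _).2 hy)
  refine hn1.not_ge ?_
  simp only [MulMemClass.coe_mul, map_mul, norm_mul, SubmonoidClass.coe_pow, map_pow,
    norm_pow, pow_succ]
  gcongr

/-- Adic congruences are norm inequalities, so an adic Cauchy sequence converges in `ℂ_[p]`, and
compactness keeps the limit in `k`. Weierstrass preparation and Hensel's lemma rest on this. -/
instance : IsAdicComplete (maximalIdeal (RingInt p k)) (RingInt p k) := by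
  obtain ⟨ϖ, h0, hm, hmax⟩ := exists_uniformizer p k
  have hspan : maximalIdeal (RingInt p k) = Ideal.span {ϖ} := by
    refine le_antisymm (fun x hx => ?_) ((Ideal.span_singleton_le_iff_mem _).2 hm)
    rw [Ideal.mem_span_singleton, dvd_iff_norm_le]
    exact hmax x hx
  have hϖ1 := (mem_maximalIdeal_iff _).1 hm
  have hlim := tendsto_pow_atTop_nhds_zero_of_lt_one
    (norm_nonneg (algebraMap k ℂ_[p] ϖ)) hϖ1
  have hmod (n : ℕ) (x y : RingInt p k) :
      x ≡ y [SMOD (maximalIdeal (RingInt p k) ^ n • ⊤ : Submodule (RingInt p k) (RingInt p k))] ↔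
        ‖algebraMap k ℂ_[p] x - algebraMap k ℂ_[p] y‖ ≤ ‖algebraMap k ℂ_[p] ϖ‖ ^ n := by
    rw [SModEq.sub_mem, smul_eq_mul, Ideal.mul_top, hspan, Ideal.span_singleton_pow,
      Ideal.mem_span_singleton, dvd_iff_norm_le]
    simp
  refine { haus' := fun x hx => ?_, prec' := fun f hf => ?_ }
  · have h1 : ‖algebraMap k ℂ_[p] x‖ ≤ 0 :=
      ge_of_tendsto' hlim fun n => by simpa using (hmod n x 0).1 (hx n)
    simpa using h1
  · have hle (a b : ℕ) (hab : a ≤ b) :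
        dist (algebraMap k ℂ_[p] (f a)) (algebraMap k ℂ_[p] (f b)) ≤
          ‖algebraMap k ℂ_[p] ϖ‖ ^ a := by
      rw [dist_eq_norm]
      exact (hmod _ _ _).1 (hf hab)
    have hcau : CauchySeq fun n => algebraMap k ℂ_[p] (f n) :=
      cauchySeq_of_le_tendsto_0' _ hle hlim
    obtain ⟨x, hx⟩ := cauchySeq_tendsto_of_complete hcau
    obtain ⟨⟨y, rfl⟩, hy⟩ := (isCompact_range_inter_closedBall p k).isClosed.mem_of_tendsto hx
      (.of_forall fun n => ⟨⟨_, rfl⟩, by simpa using norm_le_one (f n)⟩)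
    refine ⟨⟨y, (mem_iff_norm_le_one _).2 (by simpa using hy)⟩, fun n => (hmod _ _ _).2 ?_⟩
    have h3 := le_of_tendsto (tendsto_const_nhds.dist hx)
      ((Filter.eventually_ge_atTop n).mono fun b hb => hle n b hb)
    rwa [dist_eq_norm] at h3

end FiniteDimensional

end RingInt

end Integers

/-! ### Evaluation in the open disk and division by `X - z` -/

section Evaluation

variable {p : ℕ} [Fact p.Prime]

theorem norm_coe_maximalIdeal_lt_one (z : maximalIdeal 𝓞_ℂ_[p]) : ‖((z : 𝓞_ℂ_[p]) : ℂ_[p])‖ < 1 :=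
  (PadicComplexInt.mem_maximalIdeal_iff _).1 z.2

theorem norm_coeff_mul_pow_le (z : maximalIdeal 𝓞_ℂ_[p]) (g : 𝓞_ℂ_[p]⟦X⟧) (i : ℕ) :
    ‖((coeff i g : 𝓞_ℂ_[p]) : ℂ_[p]) * ((z : 𝓞_ℂ_[p]) : ℂ_[p]) ^ i‖ ≤ ‖((z : 𝓞_ℂ_[p]) : ℂ_[p])‖ ^ i := by
  rw [norm_mul, norm_pow]
  exact mul_le_of_le_one_left (by positivity)
    ((PadicComplexInt.mem_iff_norm_le_one _).1 (coeff i g).2)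

theorem summable_norm_coeff_mul_pow (z : maximalIdeal 𝓞_ℂ_[p]) (g : 𝓞_ℂ_[p]⟦X⟧) :
    Summable fun i => ‖((coeff i g : 𝓞_ℂ_[p]) : ℂ_[p]) * ((z : 𝓞_ℂ_[p]) : ℂ_[p]) ^ i‖ :=
  .of_nonneg_of_le (fun _ => norm_nonneg _) (norm_coeff_mul_pow_le z g)
    (summable_geometric_of_lt_one (norm_nonneg _) (norm_coe_maximalIdeal_lt_one z))

/-- Evaluation at a point of the open unit disk, as a ring homomorphism. -/
noncomputable def diskEval (z : maximalIdeal 𝓞_ℂ_[p]) : 𝓞_ℂ_[p]⟦X⟧ →+* 𝓞_ℂ_[p] :=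
  RingHom.codRestrict
    { toFun := fun g : 𝓞_ℂ_[p]⟦X⟧ => ∑' i, ((coeff i g : 𝓞_ℂ_[p]) : ℂ_[p]) * ((z : 𝓞_ℂ_[p]) : ℂ_[p]) ^ i
      map_one' := by
        rw [tsum_eq_single 0]
        · simp
        · intro i hi
          simp [coeff_one, hi]
      map_zero' := by simp
      map_add' := fun a b => by
        rw [← ((summable_norm_coeff_mul_pow z a).of_norm).tsum_add
          ((summable_norm_coeff_mul_pow z b).of_norm)]
        simp [add_mul]
      map_mul' := fun a b => by
        rw [tsum_mul_tsum_eq_tsum_sum_antidiagonal_of_summable_norm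
          (summable_norm_coeff_mul_pow z a) (summable_norm_coeff_mul_pow z b)]
        congr 1
        ext n
        rw [coeff_mul, AddSubmonoidClass.coe_finsetSum, Finset.sum_mul]
        refine Finset.sum_congr rfl fun i hi => ?_
        rw [MulMemClass.coe_mul, ← Finset.HasAntidiagonal.mem_antidiagonal.1 hi, pow_add]
        ring } 𝓞_ℂ_[p] fun g => by
    rw [PadicComplexInt.mem_iff_norm_le_one]
    refine IsUltrametricDist.norm_tsum_le_of_forall_le_of_nonneg zero_le_one fun i => ?_
    exact (norm_coeff_mul_pow_le z g i).trans
      (pow_le_one₀ (norm_nonneg _) (norm_coe_maximalIdeal_lt_one z).le)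

theorem coe_diskEval (z : maximalIdeal 𝓞_ℂ_[p]) (g : 𝓞_ℂ_[p]⟦X⟧) :
    (diskEval z g : ℂ_[p]) = ∑' i, ((coeff i g : 𝓞_ℂ_[p]) : ℂ_[p]) * ((z : 𝓞_ℂ_[p]) : ℂ_[p]) ^ i := rfl

@[simp]
theorem diskEval_C (z : maximalIdeal 𝓞_ℂ_[p]) (a : 𝓞_ℂ_[p]) : diskEval z (C a) = a := by
  refine Subtype.ext ?_
  rw [coe_diskEval, tsum_eq_single 0]
  · simp
  · intro i hi
    simp [coeff_C, hi]

@[simp]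
theorem diskEval_X (z : maximalIdeal 𝓞_ℂ_[p]) : diskEval z X = z := by
  refine Subtype.ext ?_
  rw [coe_diskEval, tsum_eq_single 1]
  · simp
  · intro i hi
    simp [coeff_X, hi]

theorem diskEval_coe (z : maximalIdeal 𝓞_ℂ_[p]) (P : Polynomial 𝓞_ℂ_[p]) :
    diskEval z (P : 𝓞_ℂ_[p]⟦X⟧) = P.eval (z : 𝓞_ℂ_[p]) := by
  have : (diskEval z).comp Polynomial.coeToPowerSeries.ringHom =
      Polynomial.evalRingHom (z : 𝓞_ℂ_[p]) :=
    Polynomial.ringHom_ext (by simp) (by simp)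
  exact RingHom.congr_fun this P

/-- Division of a power series by `X - z`. -/
theorem exists_eq_X_sub_C_mul_add (z : maximalIdeal 𝓞_ℂ_[p]) (g : 𝓞_ℂ_[p]⟦X⟧) :
    ∃ q : 𝓞_ℂ_[p]⟦X⟧, g = (X - C (z : 𝓞_ℂ_[p])) * q + C (diskEval z g) := by
  have hshift (n : ℕ) : diskEval z (mk fun j => coeff (n + j) g) =
      coeff n g + z * diskEval z (mk fun j => coeff (n + 1 + j) g) := by
    have h : (mk fun j => coeff (n + j) g) =
        C (coeff n g) + X * mk fun j => coeff (n + 1 + j) g := by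
      ext j
      cases j with
      | zero => simp
      | succ j => simp [show n + (j + 1) = n + 1 + j by ring]
    rw [h]
    simp
  -- The coefficients of the quotient are the values at `z` of the shifted tails of `g`, and
  -- `hshift` is the Horner recursion between them.
  refine ⟨mk fun n => diskEval z (mk fun j => coeff (n + 1 + j) g), ?_⟩
  ext1 n
  rw [sub_mul, map_add, map_sub, coeff_C_mul]
  cases n with
  | zero =>
    have h := hshift 0
    have h0 : (mk fun j => coeff (0 + j) g) = g := by ext1 j; simp
    rw [h0] at h
    simp only [zero_add] at h
    simp [h]
  | succ n =>
    rw [coeff_succ_X_mul, coeff_mk, coeff_mk, hshift (n + 1)]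
    simp

theorem X_sub_C_dvd_iff (z : maximalIdeal 𝓞_ℂ_[p]) (g : 𝓞_ℂ_[p]⟦X⟧) :
    X - C (z : 𝓞_ℂ_[p]) ∣ g ↔ diskEval z g = 0 := by
  constructor
  · rintro ⟨q, rfl⟩
    simp
  · intro h
    obtain ⟨q, hq⟩ := exists_eq_X_sub_C_mul_add z g
    exact ⟨q, by rw [h, map_zero, add_zero] at hq; exact hq⟩

theorem X_sub_C_ne_zero (z : 𝓞_ℂ_[p]) : (X - C z : 𝓞_ℂ_[p]⟦X⟧) ≠ 0 := fun h => by
  simpa [coeff_C] using congrArg (coeff 1) h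

theorem emultiplicity_X_sub_C_eq_iff (z : maximalIdeal 𝓞_ℂ_[p]) (g : 𝓞_ℂ_[p]⟦X⟧) (m : ℕ) :
    emultiplicity (X - C (z : 𝓞_ℂ_[p])) g = m ↔
      ∃ q, g = (X - C (z : 𝓞_ℂ_[p])) ^ m * q ∧ diskEval z q ≠ 0 := by
  rw [emultiplicity_eq_coe]
  constructor
  · rintro ⟨⟨q, rfl⟩, h⟩
    refine ⟨q, rfl, fun hq => h ?_⟩
    rw [pow_succ]
    exact mul_dvd_mul_left _ ((X_sub_C_dvd_iff z q).2 hq)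
  · rintro ⟨q, rfl, h⟩
    refine ⟨dvd_mul_right _ _, fun hq => h ?_⟩
    rw [pow_succ, mul_dvd_mul_iff_left (pow_ne_zero _ (X_sub_C_ne_zero _))] at hq
    exact (X_sub_C_dvd_iff z q).1 hq

theorem diskEval_mem_maximalIdeal (z : maximalIdeal 𝓞_ℂ_[p]) {w : 𝓞_ℂ_[p]⟦X⟧}
    (hw : constantCoeff w = 0) : diskEval z w ∈ maximalIdeal 𝓞_ℂ_[p] := by
  obtain ⟨q, rfl⟩ := X_dvd_iff.2 hw
  rw [map_mul, diskEval_X]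
  exact Ideal.mul_mem_right _ _ z.2

/-- Dividing `f` by `X - y`, where `y = w(z)`, avoids rearranging a double series: `f ∘ w = (w - y)
* (q ∘ w) + f(y)`, and `w - y` vanishes at `z`. -/
theorem diskEval_compose (z : maximalIdeal 𝓞_ℂ_[p]) {w : 𝓞_ℂ_[p]⟦X⟧}
    (hw : constantCoeff w = 0) (f : 𝓞_ℂ_[p]⟦X⟧) :
    diskEval z (f.compose w) = diskEval ⟨diskEval z w, diskEval_mem_maximalIdeal z hw⟩ f := by
  set y : maximalIdeal 𝓞_ℂ_[p] := ⟨diskEval z w, diskEval_mem_maximalIdeal z hw⟩ with hy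
  obtain ⟨q, hq⟩ := exists_eq_X_sub_C_mul_add y f
  conv_lhs => rw [hq]
  rw [compose_add hw, compose_mul hw, compose_sub hw, X_compose hw, C_compose, C_compose]
  simp [hy]

theorem exists_diskEval_eq (z : maximalIdeal 𝓞_ℂ_[p]) (g : 𝓞_ℂ_[p]⟦X⟧) :
    ∃ a, diskEval z g = constantCoeff g + z * a := by
  obtain ⟨q, hq⟩ := eq_C_add_X_mul g
  exact ⟨diskEval z q, by conv_lhs => rw [hq]
                          simp⟩

theorem diskEval_derivative_X_sub_C_mul (z : maximalIdeal 𝓞_ℂ_[p]) (q : 𝓞_ℂ_[p]⟦X⟧) :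
    diskEval z (derivative 𝓞_ℂ_[p] ((X - C (z : 𝓞_ℂ_[p])) * q)) = diskEval z q := by
  simp [Derivation.leibniz, derivative_C]

theorem derivative_compose {R : Type*} [CommRing R] {w : R⟦X⟧} (hw : constantCoeff w = 0)
    (f : R⟦X⟧) :
    derivative R (f.compose w) = (derivative R f).compose w * derivative R w :=
  derivative_subst (.of_constantCoeff_zero' hw)

theorem map_derivative {R S : Type*} [CommRing R] [CommRing S] (φ : R →+* S) (f : R⟦X⟧) :
    (derivative R f).map φ = derivative S (f.map φ) := by
  ext n
  simp [coeff_derivative]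

variable {k : Type*} [Field k] [Algebra k ℂ_[p]]

theorem evalDisk_eq_zero_iff (g : (RingInt p k)⟦X⟧) (z : maximalIdeal 𝓞_ℂ_[p]) :
    evalDisk g z = 0 ↔ diskEval z (g.map (RingInt.toComplex p k)) = 0 := by
  rw [← ZeroMemClass.coe_eq_zero (S' := 𝓞_ℂ_[p]), coe_diskEval]
  simp only [coeff_map]
  rfl

theorem rootMult_eq_iff (g : (RingInt p k)⟦X⟧) (z : maximalIdeal 𝓞_ℂ_[p]) (m : ℕ) :
    rootMult g z = m ↔ ∃ q, g.map (RingInt.toComplex p k) = (X - C (z : 𝓞_ℂ_[p])) ^ m * q ∧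
      diskEval z q ≠ 0 :=
  emultiplicity_X_sub_C_eq_iff _ _ _

end Evaluation

/-! ### Weierstrass preparation and extraction of an `m`-th power -/

section Factorization

/-- The exponent condition passes to coprime factors, since a prime dividing one of them does not
divide the other. This leaves the case of a prime power. -/
theorem exists_associated_pow_of_forall_prime {α : Type*} [CommMonoidWithZero α]
    [UniqueFactorizationMonoid α] {m : ℕ} (hm : m ≠ 0) (a : α)
    (h : ∀ q, Prime q → ∀ e c, e ≠ 0 → a = q ^ e * c → ¬ q ∣ c → e = m) :
    ∃ b, Associated (b ^ m) a := by
  induction a using UniqueFactorizationMonoid.induction_on_coprime with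
  | h0 => exact ⟨0, by rw [zero_pow hm]⟩
  | h1 hx => exact ⟨1, by rw [one_pow]; exact (associated_one_iff_isUnit.2 hx).symm⟩
  | @hpr q i hq =>
    by_cases hi : i = 0
    · exact ⟨1, by rw [one_pow, hi, pow_zero]⟩
    · rw [h q hq i 1 hi (mul_one _).symm fun h1 => hq.not_isUnit (isUnit_of_dvd_one h1)]
      exact ⟨q, Associated.refl _⟩
  | @hcp x y hxy hx hy =>
    obtain ⟨b, hb⟩ := hx fun q hq e c he hc hqc => h q hq e (c * y) he (by rw [hc, mul_assoc])
      fun hd => by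
        rcases hq.dvd_or_dvd hd with h1 | h1
        · exact hqc h1
        · exact hq.not_isUnit (hxy (hc ▸ dvd_mul_of_dvd_left (dvd_pow_self q he) c) h1)
    obtain ⟨b', hb'⟩ := hy fun q hq e c he hc hqc => h q hq e (c * x) he
      (by rw [hc, mul_comm x, mul_assoc]) fun hd => by
        rcases hq.dvd_or_dvd hd with h1 | h1
        · exact hqc h1
        · exact hq.not_isUnit (hxy h1 (hc ▸ dvd_mul_of_dvd_left (dvd_pow_self q he) c))
    exact ⟨b * b', by rw [mul_pow]; exact hb.mul_mul hb'⟩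

variable {p : ℕ} [Fact p.Prime] {k : Type*} [Field k] [Algebra k ℂ_[p]]

theorem diskEval_map_coe (z : maximalIdeal 𝓞_ℂ_[p]) (P : Polynomial (RingInt p k)) :
    diskEval z ((P : (RingInt p k)⟦X⟧).map (RingInt.toComplex p k)) =
      (P.map (RingInt.toComplex p k)).eval (z : 𝓞_ℂ_[p]) := by
  rw [← diskEval_coe, Polynomial.polynomial_map_coe]

/-- The roots in `ℂ_[p]` of a distinguished polynomial lie in the open unit disk. -/
theorem exists_eval_eq_zero_of_dvd_distinguished {G q : Polynomial (RingInt p k)}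
    (hG : G.IsDistinguishedAt (maximalIdeal (RingInt p k))) (hq : q ∣ G) (hdeg : q.natDegree ≠ 0) :
    ∃ y : maximalIdeal 𝓞_ℂ_[p], (q.map (RingInt.toComplex p k)).eval (y : 𝓞_ℂ_[p]) = 0 := by
  have hinj : Function.Injective ((algebraMap 𝓞_ℂ_[p] ℂ_[p]).comp (RingInt.toComplex p k)) :=
    Subtype.val_injective.comp RingInt.toComplex_injective
  obtain ⟨z, hz⟩ := IsAlgClosed.exists_root
    (q.map ((algebraMap 𝓞_ℂ_[p] ℂ_[p]).comp (RingInt.toComplex p k))) fun h => hdeg (by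
      rw [← Polynomial.natDegree_map_eq_of_injective hinj]
      exact Polynomial.natDegree_eq_of_degree_eq_some h)
  rw [← Polynomial.map_map] at hz
  have hint : IsIntegral 𝓞_ℂ_[p] z := by
    refine ⟨G.map (RingInt.toComplex p k), hG.monic.map _, ?_⟩
    rw [Polynomial.eval₂_eq_eval_map]
    exact hz.dvd (Polynomial.map_dvd _ (Polynomial.map_dvd _ hq))
  obtain ⟨y, rfl⟩ := IsIntegrallyClosed.isIntegral_iff.1 hint
  have hy : (q.map (RingInt.toComplex p k)).eval y = 0 := by
    rw [Polynomial.IsRoot, Polynomial.eval_map_apply] at hz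
    exact Subtype.val_injective hz
  refine ⟨⟨y, ?_⟩, hy⟩
  have hGy : (G.map (RingInt.toComplex p k)).eval y = 0 :=
    Polynomial.IsRoot.dvd hy (Polynomial.map_dvd _ hq)
  -- `y ^ deg G` is minus the sum of the lower terms, whose coefficients lie in the maximal ideal.
  have hpow : y ^ G.natDegree ∈ maximalIdeal 𝓞_ℂ_[p] := by
    rw [Polynomial.eval_map, Polynomial.eval₂_eq_sum_range, Finset.sum_range_succ,
      hG.monic.coeff_natDegree, map_one, one_mul] at hGy
    rw [eq_neg_of_add_eq_zero_right hGy]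
    refine neg_mem (sum_mem fun i hi => Ideal.mul_mem_right _ _ ?_)
    exact (RingInt.toComplex_mem_maximalIdeal_iff _).2 (hG.mem (Finset.mem_range.1 hi))
  exact Ideal.IsPrime.mem_of_pow_mem inferInstance _ hpow

variable [Algebra ℚ_[p] k] [IsScalarTower ℚ_[p] k ℂ_[p]] [FiniteDimensional ℚ_[p] k]

/-- A nonunit that is nonzero modulo the maximal ideal has a root in the open unit disk. -/
theorem exists_diskEval_eq_zero {g : (RingInt p k)⟦X⟧} (hg : g.map (residue _) ≠ 0)
    (hg0 : constantCoeff g ∈ maximalIdeal (RingInt p k)) :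
    ∃ y : maximalIdeal 𝓞_ℂ_[p], diskEval y (g.map (RingInt.toComplex p k)) = 0 := by
  obtain ⟨G, h, hG, hh, hGh⟩ := exists_isWeierstrassFactorization hg
  obtain ⟨y, hy⟩ := exists_eval_eq_zero_of_dvd_distinguished hG dvd_rfl fun hdeg => by
    rw [hG.monic.natDegree_eq_zero.1 hdeg, Polynomial.coe_one, one_mul] at hGh
    rw [mem_maximalIdeal, hGh] at hg0
    exact hg0 (isUnit_iff_constantCoeff.1 hh)
  exact ⟨y, by rw [hGh, map_mul, map_mul, diskEval_map_coe, hy, zero_mul]⟩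

theorem exists_eq_C_mul_of_ne_zero {R : Type*} [CommRing R] [IsDomain R]
    [IsDiscreteValuationRing R] {g : R⟦X⟧} (hg : g ≠ 0) :
    ∃ (a : R) (g₁ : R⟦X⟧), a ≠ 0 ∧ g = C a * g₁ ∧ g₁.map (residue R) ≠ 0 := by
  -- Take a coefficient of least valuation.
  obtain ⟨i, hi⟩ : ∃ i, ∀ j, coeff i g ∣ coeff j g :=
    ⟨Function.argmin fun i => IsDiscreteValuationRing.addVal R (coeff i g), fun j =>
      IsDiscreteValuationRing.addVal_le_iff_dvd.1 (Function.argmin_le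
        (fun i => IsDiscreteValuationRing.addVal R (coeff i g)) j)⟩
  choose c hc using hi
  have hi0 : coeff i g ≠ 0 := fun h => hg (by ext j; rw [hc j, h, zero_mul, map_zero])
  refine ⟨coeff i g, mk c, hi0, by ext j; rw [coeff_C_mul, coeff_mk, hc j], fun h => ?_⟩
  have h1 : c i = 1 := mul_left_cancel₀ hi0 (by rw [← hc i, mul_one])
  simpa [h1] using congrArg (coeff i) h

/-- A nonzero series has finitely many roots in the open unit disk. -/
theorem finite_setOf_diskEval_eq_zero {g : (RingInt p k)⟦X⟧} (hg : g ≠ 0) :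
    {z : maximalIdeal 𝓞_ℂ_[p] | diskEval z (g.map (RingInt.toComplex p k)) = 0}.Finite := by
  obtain ⟨a, g₁, ha, rfl, hg₁⟩ := exists_eq_C_mul_of_ne_zero hg
  obtain ⟨G, h, hG, hh, rfl⟩ := exists_isWeierstrassFactorization hg₁
  have hG0 : G.map (RingInt.toComplex p k) ≠ 0 := (hG.monic.map _).ne_zero
  refine ((Polynomial.finite_setOfPred_isRoot hG0).preimage
    (f := fun z : maximalIdeal 𝓞_ℂ_[p] => (z : 𝓞_ℂ_[p])) Subtype.val_injective.injOn).subset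
    fun z hz => ?_
  rw [Set.mem_ofPred_eq, map_mul, map_mul, map_C, diskEval_C, map_mul, map_mul,
    diskEval_map_coe] at hz
  rcases mul_eq_zero.1 hz with h1 | h1
  · exact absurd (RingInt.toComplex_injective (h1.trans (map_zero _).symm)) ha
  · rcases mul_eq_zero.1 h1 with h2 | h2
    · exact h2
    · exact absurd h2 ((hh.map _).map (diskEval z)).ne_zero

/-- The hypothesis concerns points of `ℂ_[p]`, the factorization takes place over the ring of
integers. A prime factor `q` of the Weierstrass polynomial with exponent `e` has a root `y` in the
disk, and the multiplicity of `f` at `y` is exactly `e`; so `e = m`. -/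
theorem exists_eq_X_mul_pow_mul_unit {f : (RingInt p k)⟦X⟧} (hf : f.IsNoninvertibleStable)
    {m : ℕ} (hm : m ≠ 0) (hroots : NonzeroRootsHaveMult f m) :
    ∃ P v : (RingInt p k)⟦X⟧, IsUnit v ∧ f = X * P ^ m * v := by
  obtain ⟨g, hfg, hg0⟩ := eq_X_mul hf.constantCoeff_eq_zero
  have hgres : g.map (residue (RingInt p k)) ≠ 0 := fun h =>
    hf.map_residue_ne_zero (by rw [hfg, map_mul, h, mul_zero])
  obtain ⟨G, h, hG, hh, hGh⟩ := exists_isWeierstrassFactorization hgres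
  obtain ⟨b, u, hb⟩ := exists_associated_pow_of_forall_prime hm G (by
    intro q hq e H he hGe hqH
    have hqG : q ∣ G := hGe ▸ dvd_mul_of_dvd_left (dvd_pow_self q he) H
    have hprim : q.IsPrimitive := Polynomial.isPrimitive_of_dvd hG.monic.isPrimitive hqG
    have hdeg : q.natDegree ≠ 0 := fun h0 => hq.not_isUnit (by
      rw [Polynomial.eq_C_of_natDegree_eq_zero h0]
      exact (hprim _ (by rw [← Polynomial.eq_C_of_natDegree_eq_zero h0])).map Polynomial.C)
    obtain ⟨y, hy⟩ := exists_eval_eq_zero_of_dvd_distinguished hG hqG hdeg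
    -- Gauss's lemma moves irreducibility to the field `k`, where separability and Bézout identities
    -- are available.
    have hqk : Irreducible (q.map (algebraMap (RingInt p k) k)) :=
      hprim.irreducible_iff_irreducible_map_fraction_map.1 hq.irreducible
    have : CharZero k := (RingHom.charZero_iff (algebraMap k ℂ_[p]).injective).2 inferInstance
    have hmapmap (Q : Polynomial (RingInt p k)) :
        Polynomial.eval₂ (algebraMap k ℂ_[p]) ((y : 𝓞_ℂ_[p]) : ℂ_[p])
          (Q.map (algebraMap (RingInt p k) k)) =
        (((Q.map (RingInt.toComplex p k)).eval (y : 𝓞_ℂ_[p]) : 𝓞_ℂ_[p]) : ℂ_[p]) := by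
      rw [Polynomial.eval₂_map, Polynomial.eval_map]
      exact (Polynomial.hom_eval₂ Q (RingInt.toComplex p k) (algebraMap 𝓞_ℂ_[p] ℂ_[p])
        (y : 𝓞_ℂ_[p])).symm
    have hqy : Polynomial.eval₂ (algebraMap k ℂ_[p]) ((y : 𝓞_ℂ_[p]) : ℂ_[p])
          (q.map (algebraMap (RingInt p k) k)) = 0 := by rw [hmapmap, hy]; rfl
    have hq' : ((q.map (RingInt.toComplex p k)).derivative).eval (y : 𝓞_ℂ_[p]) ≠ 0 := by
      have := hqk.separable.eval₂_derivative_ne_zero _ hqy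
      rw [Polynomial.derivative_map, hmapmap] at this
      rw [Polynomial.derivative_map]
      exact fun h0 => this (by rw [h0]; rfl)
    -- Over `k` the irreducible `q` is coprime to the cofactor `H`, so they share no root.
    have hHy : (H.map (RingInt.toComplex p k)).eval (y : 𝓞_ℂ_[p]) ≠ 0 := by
      intro h0
      have hcop := hqk.coprime_iff_not_dvd.2 fun hd =>
        hqH (hprim.dvd_of_fraction_map_dvd_fraction_map hd)
      obtain ⟨a, c, hac⟩ := hcop
      have := congrArg (Polynomial.eval₂ (algebraMap k ℂ_[p]) ((y : 𝓞_ℂ_[p]) : ℂ_[p])) hac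
      rw [Polynomial.eval₂_add, Polynomial.eval₂_mul, Polynomial.eval₂_mul, hqy, hmapmap, h0] at this
      simp at this
    obtain ⟨q₁, hq₁⟩ := Polynomial.dvd_iff_isRoot.2 hy
    have hq₁y : q₁.eval (y : 𝓞_ℂ_[p]) ≠ 0 := by
      rw [hq₁] at hq'
      simpa [Polynomial.derivative_mul] using hq'
    have hy0 : y ≠ 0 := by
      rintro rfl
      refine hf.stable.1 ?_
      have hq0 : q.coeff 0 = 0 := RingInt.toComplex_injective (by
        rw [map_zero, ← hy, ZeroMemClass.coe_zero, ← Polynomial.coeff_zero_eq_eval_zero,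
          Polynomial.coeff_map])
      rw [← hg0, hGh, hGe]
      simp [hq0, he]
    have hmult : rootMult f y = e := by
      rw [rootMult_eq_iff]
      refine ⟨X * (q₁ : 𝓞_ℂ_[p]⟦X⟧) ^ e * (H.map (RingInt.toComplex p k) : 𝓞_ℂ_[p]⟦X⟧) *
        h.map (RingInt.toComplex p k), ?_, ?_⟩
      · rw [hfg, hGh, hGe, Polynomial.coe_mul, Polynomial.coe_pow, map_mul, map_mul, map_mul,
          map_pow, ← Polynomial.polynomial_map_coe, hq₁, Polynomial.polynomial_map_coe, map_X]
        simp only [Polynomial.coe_mul, Polynomial.coe_sub, Polynomial.coe_X, Polynomial.coe_C, mul_pow]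
        ring
      · simp only [map_mul, map_pow, diskEval_X, diskEval_coe]
        refine mul_ne_zero (mul_ne_zero (mul_ne_zero ?_ (pow_ne_zero _ hq₁y)) hHy)
          ((hh.map _).map (diskEval y)).ne_zero
        exact fun h0 => hy0 (Subtype.ext h0)
    have hfy : evalDisk f y = 0 := by
      rw [evalDisk_eq_zero_iff, hfg, hGh, map_mul, map_mul, map_mul, map_mul, diskEval_map_coe,
        Polynomial.IsRoot.dvd hy (Polynomial.map_dvd _ hqG), zero_mul, mul_zero]
    exact_mod_cast hmult.symm.trans (hroots y hy0 hfy))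
  refine ⟨b, ((u : Polynomial (RingInt p k)) : (RingInt p k)⟦X⟧) * h,
    (u.isUnit.map Polynomial.coeToPowerSeries.ringHom).mul hh, ?_⟩
  rw [hfg, hGh, ← hb, Polynomial.coe_mul, Polynomial.coe_pow]
  ring

end Factorization

/-! ### Critical points and the proof that `p` does not divide `m` -/

section Dynamics

theorem PowerSeries.compIter_add {R : Type*} [CommRing R] {f : R⟦X⟧} (hf : constantCoeff f = 0)
    (i j : ℕ) : f.compIter (i + j) = (f.compIter i).compose (f.compIter j) := by
  have hj := constantCoeff_compIter hf j
  induction i with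
  | zero => rw [zero_add, compIter, X_compose hj]
  | succ i ih =>
    rw [Nat.succ_add, compIter, compIter, ih, compose_assoc (constantCoeff_compIter hf i) hj]

theorem PowerSeries.compIter_compose_compIter {R : Type*} [CommRing R] {f u : R⟦X⟧}
    (hf : constantCoeff f = 0) (hu : constantCoeff u = 0) (h : f.compose u = u.compose f)
    (i j : ℕ) : (f.compIter i).compose (u.compIter j) = (u.compIter j).compose (f.compIter i) :=
  (compIter_compose hu hu (constantCoeff_compIter hf i)
    (compIter_compose hf hf hu h i).symm j).symm

variable {p : ℕ} [Fact p.Prime]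

/-- With `f = X * q`, one has `‖q(w)‖ ≤ max ‖q(0)‖ ‖w‖`, so on the ball of radius `‖y‖` each
application of `f` shrinks the norm by the factor `c < 1`. -/
theorem exists_norm_diskEval_compIter_lt {f : 𝓞_ℂ_[p]⟦X⟧} (hf : constantCoeff f = 0)
    (hf' : f.derivZero ∈ maximalIdeal 𝓞_ℂ_[p]) (y : maximalIdeal 𝓞_ℂ_[p]) {ε : ℝ} (hε : 0 < ε) :
    ∃ n, ‖(diskEval y (f.compIter n) : ℂ_[p])‖ < ε := by
  obtain ⟨q, rfl, hq⟩ := eq_X_mul hf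
  rw [← hq, PadicComplexInt.mem_maximalIdeal_iff] at hf'
  have hy := norm_coe_maximalIdeal_lt_one y
  set c := max ‖((constantCoeff q : 𝓞_ℂ_[p]) : ℂ_[p])‖ ‖((y : 𝓞_ℂ_[p]) : ℂ_[p])‖ with hc
  have hc0 : 0 ≤ c := le_max_of_le_left (norm_nonneg _)
  have hc1 : c < 1 := max_lt hf' hy
  have hstep (n : ℕ) : ‖(diskEval y ((X * q).compIter n) : ℂ_[p])‖ ≤
      c ^ n * ‖((y : 𝓞_ℂ_[p]) : ℂ_[p])‖ := by
    induction n with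
    | zero => simp [compIter]
    | succ n ih =>
      have hn := constantCoeff_compIter hf n
      rw [compIter, diskEval_compose y hn]
      set w : maximalIdeal 𝓞_ℂ_[p] := ⟨_, diskEval_mem_maximalIdeal y hn⟩
      have hw : ‖((w : 𝓞_ℂ_[p]) : ℂ_[p])‖ ≤ c ^ n * ‖((y : 𝓞_ℂ_[p]) : ℂ_[p])‖ := ih
      have hwy : ‖((w : 𝓞_ℂ_[p]) : ℂ_[p])‖ ≤ ‖((y : 𝓞_ℂ_[p]) : ℂ_[p])‖ :=
        hw.trans (mul_le_of_le_one_left (norm_nonneg _) (pow_le_one₀ hc0 hc1.le))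
      obtain ⟨a, ha⟩ := exists_diskEval_eq w q
      have hq' : ‖(diskEval w q : ℂ_[p])‖ ≤ c := by
        rw [ha, AddMemClass.coe_add, MulMemClass.coe_mul]
        refine (PadicComplex.isNonarchimedean p _ _).trans (max_le_max le_rfl ?_)
        rw [norm_mul]
        exact (mul_le_of_le_one_right (norm_nonneg _)
          ((PadicComplexInt.mem_iff_norm_le_one _).1 a.2)).trans hwy
      rw [map_mul, diskEval_X, MulMemClass.coe_mul, norm_mul, pow_succ', mul_assoc, mul_comm]
      exact mul_le_mul hq' hw (norm_nonneg _) hc0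
  obtain ⟨n, hn⟩ := exists_pow_lt_of_lt_one hε hc1
  exact ⟨n, (hstep n).trans_lt
    ((mul_le_of_le_one_right (pow_nonneg hc0 n) hy.le).trans_lt hn)⟩

/-- Write `w = X * q`. A nonzero fixed point satisfies `q(x) = 1`, whereas `q(x) - w'(0)` is a
multiple of `x`; this forces `‖w'(0) - 1‖ ≤ ‖x‖`. -/
theorem eq_zero_of_diskEval_eq_self {w : 𝓞_ℂ_[p]⟦X⟧} (hw : constantCoeff w = 0)
    {x : maximalIdeal 𝓞_ℂ_[p]} (hx : diskEval x w = x)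
    (hlt : ‖((x : 𝓞_ℂ_[p]) : ℂ_[p])‖ < ‖((w.derivZero - 1 : 𝓞_ℂ_[p]) : ℂ_[p])‖) :
    (x : 𝓞_ℂ_[p]) = 0 := by
  obtain ⟨q, rfl, hq⟩ := eq_X_mul hw
  by_contra h0
  rw [map_mul, diskEval_X] at hx
  have h1 : diskEval x q = 1 := mul_left_cancel₀ h0 (hx.trans (mul_one _).symm)
  obtain ⟨a, ha⟩ := exists_diskEval_eq x q
  have h2 : (X * q).derivZero - 1 = -((x : 𝓞_ℂ_[p]) * a) := by
    rw [← hq]; linear_combination ha.symm.trans h1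
  rw [h2, NegMemClass.coe_neg, norm_neg, MulMemClass.coe_mul, norm_mul] at hlt
  exact hlt.not_ge (mul_le_of_le_one_right (norm_nonneg _)
    ((PadicComplexInt.mem_iff_norm_le_one _).1 a.2))

theorem eq_zero_of_diskEval_eq_zero {u : 𝓞_ℂ_[p]⟦X⟧} (hu : constantCoeff u = 0)
    (hu' : IsUnit u.derivZero) {x : maximalIdeal 𝓞_ℂ_[p]} (hx : diskEval x u = 0) :
    (x : 𝓞_ℂ_[p]) = 0 := by
  obtain ⟨q, rfl, hq⟩ := eq_X_mul hu
  rw [map_mul, diskEval_X] at hx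
  exact (mul_eq_zero.1 hx).resolve_right
    ((isUnit_iff_constantCoeff.2 (hq ▸ hu')).map (diskEval x)).ne_zero

/-- If `f` commutes with a stable invertible series, every critical point of `f` is a root of an
iterate of `f`. -/
theorem exists_diskEval_compIter_eq_zero {f u : 𝓞_ℂ_[p]⟦X⟧} (hf : constantCoeff f = 0)
    (hf' : f.derivZero ∈ maximalIdeal 𝓞_ℂ_[p])
    (hfin : {z : maximalIdeal 𝓞_ℂ_[p] | diskEval z (derivative _ f) = 0}.Finite)
    (hu : constantCoeff u = 0) (hu' : IsUnit u.derivZero) (hustab : u.IsStable)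
    (hcomm : f.compose u = u.compose f) {z : maximalIdeal 𝓞_ℂ_[p]}
    (hz : diskEval z (derivative _ f) = 0) : ∃ n, diskEval z (f.compIter n) = 0 := by
  have hun := constantCoeff_compIter hu
  have hfn := constantCoeff_compIter hf
  let σ (n : ℕ) : maximalIdeal 𝓞_ℂ_[p] := ⟨_, diskEval_mem_maximalIdeal z (hun n)⟩
  -- Differentiating `f ∘ u = u ∘ f` at a critical point `x` gives `f'(u(x)) * u'(x) = 0`, and `u'`
  -- is a unit series.
  have hσ (n : ℕ) : diskEval (σ n) (derivative _ f) = 0 := by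
    induction n with
    | zero =>
      have : σ 0 = z := Subtype.ext (by simp [σ, compIter])
      rw [this, hz]
    | succ n ih =>
      have h1 : σ (n + 1) = ⟨diskEval (σ n) u, diskEval_mem_maximalIdeal (σ n) hu⟩ :=
        Subtype.ext (by
          change diskEval z (u.compIter (n + 1)) = _
          rw [compIter, diskEval_compose z (hun n)])
      have h2 := congrArg (diskEval (σ n)) (congrArg (derivative _) hcomm)
      rw [derivative_compose hu, derivative_compose hf, map_mul, map_mul, ih, mul_zero,
        diskEval_compose _ hu, ← h1] at h2
      refine (mul_eq_zero.1 h2).resolve_right (IsUnit.ne_zero ?_)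
      refine IsUnit.map (diskEval (σ n)) (isUnit_iff_constantCoeff.2 ?_)
      rwa [constantCoeff_derivative]
  obtain ⟨i, -, j, -, hij, hσij⟩ := Set.infinite_univ.exists_ne_map_eq_of_mapsTo
    (fun n _ => hσ n) hfin
  wlog hlt : i < j generalizing i j
  · exact this j i hij.symm hσij.symm (by omega)
  obtain ⟨N, rfl⟩ := Nat.exists_eq_add_of_lt hlt
  set w := u.compIter (N + 1) with hw
  have hw0 : constantCoeff w = 0 := hun _
  have hfix : diskEval (σ i) w = σ i := by
    have h1 : (σ (i + N + 1) : 𝓞_ℂ_[p]) = diskEval (σ i) w := by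
      change diskEval z (u.compIter (i + N + 1)) = _
      rw [show i + N + 1 = (N + 1) + i by ring, compIter_add hu, diskEval_compose z (hun i)]
    rw [← h1, ← hσij]
  have hw1 : w.derivZero - 1 ≠ 0 := by
    rw [hw, derivZero_compIter hu, sub_ne_zero]
    exact hustab.2 _ (by omega)
  -- The image of `σ i` under `f.compIter n` is still fixed by `w`, and for this `n` it is too close
  -- to `0` to be a nonzero fixed point.
  obtain ⟨n, hn⟩ := exists_norm_diskEval_compIter_lt hf hf' (σ i)
    (ε := ‖((w.derivZero - 1 : 𝓞_ℂ_[p]) : ℂ_[p])‖)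
    (norm_pos_iff.2 fun h => hw1 (Subtype.ext h))
  have h0 : diskEval (σ i) (f.compIter n) = 0 := by
    refine eq_zero_of_diskEval_eq_self hw0
      (x := ⟨_, diskEval_mem_maximalIdeal (σ i) (hfn n)⟩) ?_ hn
    rw [← diskEval_compose _ (hfn n), hw, ← compIter_compose_compIter hf hu hcomm,
      diskEval_compose _ (hun _)]
    congr 2
    exact Subtype.ext hfix
  -- Pass from `σ i` back to `z`: `u.compIter i` commutes with the iterates of `f` and vanishes only
  -- at `0`.
  refine ⟨n, eq_zero_of_diskEval_eq_zero (hun i) ?_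
    (x := ⟨_, diskEval_mem_maximalIdeal z (hfn n)⟩) ?_⟩
  · rw [derivZero_compIter hu]; exact hu'.pow i
  · rw [← diskEval_compose _ (hfn n), ← compIter_compose_compIter hf hu hcomm, diskEval_compose _ (hun _)]
    exact h0

/-- When the nonzero roots of all iterates have the same multiplicity, a critical point that is a
root of an iterate of `f` is a root of `f`. -/
theorem diskEval_eq_zero_of_critical {f : 𝓞_ℂ_[p]⟦X⟧} (hf : constantCoeff f = 0) {m : ℕ}
    (hm : m ≠ 0)
    (hroots : ∀ n : ℕ, 1 ≤ n → ∀ z : maximalIdeal 𝓞_ℂ_[p], z ≠ 0 →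
      diskEval z (f.compIter n) = 0 → emultiplicity (X - C (z : 𝓞_ℂ_[p])) (f.compIter n) = m)
    {z : maximalIdeal 𝓞_ℂ_[p]} (hz0 : z ≠ 0) (hz : diskEval z (derivative _ f) = 0)
    (hn : ∃ n, diskEval z (f.compIter n) = 0) : diskEval z f = 0 := by
  classical
  by_contra hfz
  have hfn := constantCoeff_compIter hf
  obtain ⟨n, hn, hmin⟩ : ∃ n, diskEval z (f.compIter n) = 0 ∧
      ∀ i < n, diskEval z (f.compIter i) ≠ 0 :=
    ⟨Nat.find hn, Nat.find_spec hn, fun i => Nat.find_min hn⟩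
  have h1 : f.compIter 1 = f := by rw [compIter, compIter, compose_X]
  match n with
  | 0 =>
    rw [compIter, diskEval_X] at hn
    exact hz0 (Subtype.ext hn)
  | 1 => exact hfz (by rwa [h1] at hn)
  | n + 2 =>
    set F := f.compIter (n + 1) with hF
    have hF0 : constantCoeff F = 0 := hfn _
    have hF' : diskEval z (derivative _ F) = 0 := by
      have hcomm : F = (f.compIter n).compose f := by
        rw [hF, compIter_add hf, h1]
      rw [hcomm, derivative_compose hf, map_mul, hz, mul_zero]
    set β : maximalIdeal 𝓞_ℂ_[p] := ⟨_, diskEval_mem_maximalIdeal z hF0⟩ with hβ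
    have hβ0 : β ≠ 0 := fun h => hmin (n + 1) (by omega) (congrArg Subtype.val h)
    have hfβ : diskEval β f = 0 := by
      rw [← hn, compIter, diskEval_compose z hF0]
    have hβm := hroots 1 le_rfl β hβ0 (by rw [h1, hfβ])
    rw [h1, emultiplicity_X_sub_C_eq_iff] at hβm
    obtain ⟨q, hq, -⟩ := hβm
    -- Since `F'(z) = 0`, the difference `F - β` is divisible by `(X - z) ^ 2`. As `β` is a root of
    -- `f` of multiplicity `m`, the composite vanishes at `z` to order at least `2 * m ≥ m + 1`.
    obtain ⟨F₁, hF₁⟩ : X - C (z : 𝓞_ℂ_[p]) ∣ F - C (β : 𝓞_ℂ_[p]) := by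
      rw [X_sub_C_dvd_iff, map_sub, diskEval_C, hβ, sub_self]
    obtain ⟨F₂, hF₂⟩ : X - C (z : 𝓞_ℂ_[p]) ∣ F₁ := by
      rw [X_sub_C_dvd_iff, ← diskEval_derivative_X_sub_C_mul, ← hF₁, map_sub, derivative_C,
        sub_zero, hF']
    have hmul := hroots (n + 2) (by omega) z hz0 hn
    rw [emultiplicity_eq_coe] at hmul
    refine hmul.2 ?_
    have hcomp : f.compIter (n + 2) = (F - C (β : 𝓞_ℂ_[p])) ^ m * q.compose F := by
      change f.compose F = _
      conv_lhs => rw [hq]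
      rw [compose_mul hF0, compose_pow hF0, compose_sub hF0, X_compose hF0, C_compose]
    rw [hcomp, hF₁, hF₂, ← mul_assoc, ← pow_two, mul_pow, ← pow_mul, mul_assoc]
    exact dvd_mul_of_dvd_left (pow_dvd_pow _ (by omega)) _

variable {k : Type*} [Field k] [Algebra k ℂ_[p]] [Algebra ℚ_[p] k] [IsScalarTower ℚ_[p] k ℂ_[p]]
  [FiniteDimensional ℚ_[p] k]

/-- If `p ∣ m`, the term of `f'` carrying the factor `m` disappears modulo the maximal ideal. This
produces a critical point of `f` that is not a root of `f`, which the two preceding results exclude.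
-/
theorem not_dvd_of_commInvertible_stable {f : (RingInt p k)⟦X⟧} (hf : f.IsNoninvertibleStable)
    {m : ℕ} (hm : m ≠ 0) (hroots : ∀ n : ℕ, 1 ≤ n → NonzeroRootsHaveMult (f.compIter n) m)
    {u : (RingInt p k)⟦X⟧} (hu : u ∈ f.commInvertible) (hustab : u.IsStable) : ¬ p ∣ m := by
  intro hpm
  obtain ⟨hu0, hu1, hu2⟩ := hu
  have hf0 := hf.constantCoeff_eq_zero
  have hφ : Function.Injective (RingInt.toComplex p k) := RingInt.toComplex_injective
  have hroots1 : NonzeroRootsHaveMult f m := by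
    have := hroots 1 le_rfl
    rwa [compIter, compIter, compose_X] at this
  obtain ⟨P, v, hv, hfP⟩ := exists_eq_X_mul_pow_mul_unit hf hm hroots1
  obtain ⟨r, rfl⟩ := Nat.exists_eq_add_one_of_ne_zero hm
  set Q := P * v + ((r + 1 : ℕ) : (RingInt p k)⟦X⟧) * (X * derivative _ P * v) +
    X * P * derivative _ v with hQ
  have hfQ : derivative _ f = P ^ r * Q := by
    rw [hfP, hQ]
    simp only [Derivation.leibniz, Derivation.leibniz_pow, derivative_X, smul_eq_mul, nsmul_eq_mul]
    push_cast
    ring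
  have hfd : f.derivZero = constantCoeff P ^ (r + 1) * constantCoeff v := by
    rw [hfP, mul_assoc, derivZero_X_mul, map_mul, map_pow]
  have hv0 : IsUnit (constantCoeff v) := isUnit_iff_constantCoeff.1 hv
  have hP0 : constantCoeff P ≠ 0 := fun h => hf.stable.1 (by rw [hfd, h]; simp)
  have hPm : constantCoeff P ∈ maximalIdeal (RingInt p k) := by
    have := hf.noninvertible
    rw [hfd] at this
    exact Ideal.IsPrime.mem_of_pow_mem inferInstance _
      ((Ideal.IsPrime.mem_or_mem inferInstance this).resolve_right fun h => h hv0)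
  have hQ0 : constantCoeff Q = constantCoeff P * constantCoeff v := by
    rw [hQ]; simp
  have hPres : P.map (residue (RingInt p k)) ≠ 0 := fun h =>
    hf.map_residue_ne_zero (by rw [hfP, map_mul, map_mul, map_pow, h]; simp)
  -- Modulo the maximal ideal `Q` becomes `P * (v + X * v')`, and the second factor has unit
  -- constant coefficient.
  have hQres : Q.map (residue (RingInt p k)) ≠ 0 := by
    have h1 : (residue (RingInt p k)) ((r + 1 : ℕ) : RingInt p k) = 0 :=
      (residue_eq_zero_iff _).2 (RingInt.natCast_mem_maximalIdeal hpm)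
    have h2 : (((r + 1 : ℕ) : (RingInt p k)⟦X⟧)).map (residue (RingInt p k)) = 0 := by
      rw [← map_natCast (C (R := RingInt p k)), map_C, h1, map_zero]
    have h3 : Q.map (residue (RingInt p k)) = P.map (residue (RingInt p k)) *
        (v + X * derivative _ v).map (residue (RingInt p k)) := by
      rw [hQ, map_add, map_add, map_mul, map_mul _ ((r + 1 : ℕ) : (RingInt p k)⟦X⟧), h2]
      simp only [map_mul, map_add]
      ring
    rw [h3]
    refine mul_ne_zero hPres fun h => ?_
    have h4 := congrArg constantCoeff h
    rw [constantCoeff_map_apply, map_zero, residue_eq_zero_iff] at h4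
    simp at h4
    exact h4 hv0
  obtain ⟨z, hz⟩ := exists_diskEval_eq_zero hQres
    (by rw [hQ0]; exact Ideal.mul_mem_right _ _ hPm)
  have hz0 : z ≠ 0 := by
    rintro rfl
    obtain ⟨a, ha⟩ := exists_diskEval_eq (0 : maximalIdeal 𝓞_ℂ_[p]) (Q.map (RingInt.toComplex p k))
    rw [hz, ZeroMemClass.coe_zero, zero_mul, add_zero, constantCoeff_map_apply, hQ0] at ha
    exact mul_ne_zero hP0 hv0.ne_zero (hφ (ha.symm.trans (map_zero _).symm))
  have hz0' : (z : 𝓞_ℂ_[p]) ≠ 0 := fun h => hz0 (Subtype.ext h)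
  have hvz : diskEval z (v.map (RingInt.toComplex p k)) ≠ 0 := ((hv.map _).map (diskEval z)).ne_zero
  have hfz_eq : diskEval z (f.map (RingInt.toComplex p k)) =
      z * diskEval z (P.map (RingInt.toComplex p k)) ^ (r + 1) *
        diskEval z (v.map (RingInt.toComplex p k)) := by
    rw [hfP]; simp
  -- At a root of `P` only `m * z * P'(z) * v(z)` would survive in `Q(z)`. It is nonzero, because
  -- multiplicity `m` for `f` makes that root of `P` simple.
  have hPz : diskEval z (P.map (RingInt.toComplex p k)) ≠ 0 := by
    intro h
    have hmult := (rootMult_eq_iff _ _ _).1 (hroots1 z hz0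
      ((evalDisk_eq_zero_iff _ _).2 (by rw [hfz_eq, h]; simp)))
    obtain ⟨q, hq, hqz⟩ := hmult
    obtain ⟨P₁, hP₁⟩ := (X_sub_C_dvd_iff z _).2 h
    have hP₁z : diskEval z P₁ ≠ 0 := by
      intro h0
      have hq' : q = X * P₁ ^ (r + 1) * v.map (RingInt.toComplex p k) := by
        refine mul_left_cancel₀ (pow_ne_zero (r + 1) (X_sub_C_ne_zero (z : 𝓞_ℂ_[p]))) ?_
        refine hq.symm.trans ?_
        rw [hfP, map_mul, map_mul, map_pow, map_X, hP₁, mul_pow]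
        ring
      exact hqz (by rw [hq', map_mul, map_mul, map_pow, h0]; simp)
    have hP'z : diskEval z ((derivative _ P).map (RingInt.toComplex p k)) ≠ 0 := by
      rw [map_derivative, hP₁, diskEval_derivative_X_sub_C_mul]
      exact hP₁z
    rw [hQ] at hz
    simp only [map_add, map_mul, map_X, diskEval_X, h, zero_mul, mul_zero, zero_add, add_zero,
      map_natCast] at hz
    have : ((r + 1 : ℕ) : 𝓞_ℂ_[p]) ≠ 0 := fun h0 => by
      have := congrArg Subtype.val h0
      have h5 : ((r + 1 : ℕ) : ℂ_[p]) = 0 := by simpa using this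
      exact Nat.succ_ne_zero r (Nat.cast_eq_zero.1 h5)
    exact mul_ne_zero this (mul_ne_zero (mul_ne_zero hz0' hP'z) hvz) hz
  have hfz : diskEval z (f.map (RingInt.toComplex p k)) ≠ 0 := by
    rw [hfz_eq]
    exact mul_ne_zero (mul_ne_zero hz0' (pow_ne_zero _ hPz)) hvz
  have hcrit : diskEval z (derivative _ (f.map (RingInt.toComplex p k))) = 0 := by
    rw [← map_derivative, hfQ, map_mul, map_mul, hz, mul_zero]
  have hff : constantCoeff (f.map (RingInt.toComplex p k)) = 0 := by rw [constantCoeff_map_apply, hf0, map_zero]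
  have huu : constantCoeff (u.map (RingInt.toComplex p k)) = 0 := by rw [constantCoeff_map_apply, hu0, map_zero]
  have hder : derivative _ f ≠ 0 := fun h => hf.stable.1 (by
    rw [← constantCoeff_derivative, h, map_zero])
  refine hfz (diskEval_eq_zero_of_critical hff hm (fun n hn y hy hny => ?_) hz0 hcrit
    (exists_diskEval_compIter_eq_zero hff ?_ ?_ huu ?_ ⟨?_, ?_⟩ ?_ hcrit))
  · rw [← map_compIter hf0] at hny ⊢
    exact hroots n hn y hy ((evalDisk_eq_zero_iff _ _).2 hny)
  · rw [derivZero_map]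
    exact (RingInt.toComplex_mem_maximalIdeal_iff _).2 hf.noninvertible
  · simp_rw [← map_derivative]
    exact finite_setOf_diskEval_eq_zero hder
  · rw [derivZero_map]; exact hu1.map _
  · rw [derivZero_map]; exact (map_ne_zero_iff _ hφ).2 hustab.1
  · intro n hn h
    rw [derivZero_map, ← map_pow] at h
    exact hustab.2 n hn (hφ (h.trans (map_one _).symm))
  · rw [← map_compose hu0, hu2, map_compose hf0]

end Dynamics

/-! ### Unramified extensions and `m`-th roots of units -/

section Unramified

variable {p : ℕ} [Fact p.Prime]

theorem eval₂_mem_maximalIdeal_of_map_residue_eq_zero {k l : Type*} [Field k] [Field l]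
    [Algebra k ℂ_[p]] [Algebra l ℂ_[p]] [Algebra k l] [IsScalarTower k l ℂ_[p]]
    {D : Polynomial (RingInt p k)} (hD : D.map (residue _) = 0) (t : RingInt p l) :
    D.eval₂ (RingInt.incl p k l) t ∈ maximalIdeal (RingInt p l) := by
  rw [Polynomial.eval₂_eq_sum_range]
  refine sum_mem fun i _ => Ideal.mul_mem_right _ _ ((RingInt.incl_mem_maximalIdeal_iff _).2 ?_)
  rw [← residue_eq_zero_iff, ← Polynomial.coeff_map, hD, Polynomial.coeff_zero]

/-- A nonzero polynomial over `k` is a scalar multiple of an integral polynomial with a coefficient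
equal to one. -/
theorem exists_eq_C_mul_map_of_ne_zero {k : Type*} [Field k] [Algebra k ℂ_[p]]
    {S : Polynomial k} (hS : S ≠ 0) :
    ∃ (a : k) (S₁ : Polynomial (RingInt p k)), a ≠ 0 ∧
      S = Polynomial.C a * S₁.map (RingInt p k).subtype ∧ S₁.map (residue _) ≠ 0 := by
  obtain ⟨i, hi, hmax⟩ := S.support.exists_max_image (fun i => ‖algebraMap k ℂ_[p] (S.coeff i)‖)
    (Polynomial.support_nonempty.2 hS)
  have hi0 : S.coeff i ≠ 0 := Polynomial.mem_support_iff.1 hi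
  have hle (j : ℕ) :
      ‖algebraMap k ℂ_[p] (S.coeff j)‖ ≤ ‖algebraMap k ℂ_[p] (S.coeff i)‖ := by
    by_cases hj : j ∈ S.support
    · exact hmax j hj
    · rw [Polynomial.notMem_support_iff.1 hj, map_zero, norm_zero]
      exact norm_nonneg _
  have hlift : Polynomial.C (S.coeff i)⁻¹ * S ∈ Polynomial.lifts (RingInt p k).subtype := by
    rw [Polynomial.lifts_iff_coeff_lifts]
    intro j
    refine ⟨⟨(S.coeff i)⁻¹ * S.coeff j, (RingInt.mem_iff_norm_le_one _).2 ?_⟩, ?_⟩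
    · rw [map_mul, map_inv₀, norm_mul, norm_inv]
      exact inv_mul_le_one_of_le₀ (hle j) (norm_nonneg _)
    · rw [Polynomial.coeff_C_mul]; rfl
  obtain ⟨S₁, hS₁⟩ := hlift
  rw [Polynomial.coe_mapRingHom] at hS₁
  refine ⟨S.coeff i, S₁, hi0, ?_, fun h => ?_⟩
  · rw [hS₁, ← mul_assoc, ← Polynomial.C_mul, mul_inv_cancel₀ hi0, Polynomial.C_1, one_mul]
  · have h1 : S₁.coeff i = 1 := by
      refine Subtype.ext ?_
      have := congrArg (fun T => Polynomial.coeff T i) hS₁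
      simpa [Polynomial.coeff_map, hi0] using this
    have h2 := congrArg (fun T => Polynomial.coeff T i) h
    simp [Polynomial.coeff_map, h1] at h2

/-- The extension generated by a root of a monic integral polynomial whose reduction is irreducible
is unramified. -/
theorem isUnramifiedExt_adjoin_root {k l : Type*} [Field k] [Field l] [Algebra k ℂ_[p]]
    [Algebra l ℂ_[p]] [Algebra k l] [IsScalarTower k l ℂ_[p]] {Q : Polynomial (RingInt p k)} (hQ : Q.Monic)
    (hirr : Irreducible (Q.map (residue _))) {t : RingInt p l}
    (ht : Q.eval₂ (RingInt.incl p k l) t = 0)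
    (hgen : ∀ y : l, ∃ S : Polynomial k, Polynomial.aeval (t : l) S = y) :
    IsUnramifiedExt p k l := by
  refine le_antisymm (Ideal.map_le_iff_le_comap.2 fun x hx =>
    (RingInt.incl_mem_maximalIdeal_iff _).2 hx) fun y hy => ?_
  by_cases hy0 : y = 0
  · rw [hy0]; exact Ideal.zero_mem _
  have hcoe (D : Polynomial (RingInt p k)) :
      Polynomial.aeval (t : l) (D.map (RingInt p k).subtype) =
        (D.eval₂ (RingInt.incl p k l) t : RingInt p l) := by
    rw [Polynomial.aeval_def, Polynomial.eval₂_map]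
    exact (Polynomial.hom_eval₂ D (RingInt.incl p k l) (RingInt p l).subtype t).symm
  obtain ⟨S, hS⟩ := hgen y
  -- Represent `y` by the remainder modulo `Q` and normalize it to `a * S₁`. The reduction of `S₁`
  -- is nonzero of degree less than that of the irreducible reduction of `Q`, hence coprime to it.
  -- So `S₁(t)` is a unit, and `y` has the norm of `a ∈ k`.
  set Qk := Q.map (RingInt p k).subtype with hQk
  have hQkm : Qk.Monic := hQ.map _
  have hSmod : Polynomial.aeval (t : l) (S %ₘ Qk) = (y : l) := by
    rw [← hS]
    conv_rhs => rw [← Polynomial.modByMonic_add_div S Qk]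
    rw [map_add, map_mul, hcoe, ht]
    simp
  have hS0 : S %ₘ Qk ≠ 0 := fun h => hy0 (Subtype.ext (by rw [← hSmod, h, map_zero]; rfl))
  obtain ⟨a, S₁, ha, hSa, hS₁⟩ := exists_eq_C_mul_map_of_ne_zero (p := p) hS0
  have hdeg : (S₁.map (residue (RingInt p k))).degree < (Q.map (residue (RingInt p k))).degree := by
    have h1 := Polynomial.degree_modByMonic_lt S hQkm
    rw [hSa, Polynomial.degree_C_mul ha, hQk,
      Polynomial.degree_map_eq_of_injective Subtype.val_injective,
      Polynomial.degree_map_eq_of_injective Subtype.val_injective] at h1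
    rw [hQ.degree_map]
    exact Polynomial.degree_map_le.trans_lt h1
  have hcop : IsCoprime (Q.map (residue (RingInt p k))) (S₁.map (residue (RingInt p k))) :=
    hirr.coprime_iff_not_dvd.2 (Polynomial.not_dvd_of_degree_lt hS₁ hdeg)
  obtain ⟨A, B, hAB⟩ := hcop
  obtain ⟨A, rfl⟩ := Polynomial.map_surjective _ (residue_surjective (R := RingInt p k)) A
  obtain ⟨B, rfl⟩ := Polynomial.map_surjective _ (residue_surjective (R := RingInt p k)) B
  have hmem := eval₂_mem_maximalIdeal_of_map_residue_eq_zero (l := l)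
    (D := A * Q + B * S₁ - 1) (by simp [hAB]) t
  rw [Polynomial.eval₂_sub, Polynomial.eval₂_add, Polynomial.eval₂_mul, Polynomial.eval₂_mul, ht,
    mul_zero, zero_add, Polynomial.eval₂_one] at hmem
  have hunit : IsUnit (S₁.eval₂ (RingInt.incl p k l) t) := by
    by_contra h
    have h1 := sub_mem (Ideal.mul_mem_left _ (B.eval₂ (RingInt.incl p k l) t)
      ((mem_maximalIdeal _).2 h)) hmem
    rw [sub_sub_cancel, mem_maximalIdeal] at h1
    exact h1 isUnit_one
  have hya : (y : l) = algebraMap k l a * (S₁.eval₂ (RingInt.incl p k l) t : RingInt p l) := by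
    rw [← hSmod, hSa, map_mul, Polynomial.aeval_C, hcoe]
  have hnorm : ‖algebraMap k ℂ_[p] a‖ < 1 := by
    have h1 := (RingInt.mem_maximalIdeal_iff _).1 hy
    rw [hya, map_mul, norm_mul, (RingInt.isUnit_iff_norm_eq_one _).1 hunit, mul_one,
      ← IsScalarTower.algebraMap_apply] at h1
    exact h1
  set a' : RingInt p k := ⟨a, (RingInt.mem_iff_norm_le_one _).2 hnorm.le⟩
  have hya' : y = RingInt.incl p k l a' * S₁.eval₂ (RingInt.incl p k l) t := Subtype.ext hya
  rw [hya']
  exact Ideal.mul_mem_right _ _ (Ideal.mem_map_of_mem _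
    ((RingInt.mem_maximalIdeal_iff a').2 hnorm))

/-- Hensel's lemma for `Y ^ m - a`: the approximate root `t` is a unit because `a` is, and `m` is a
unit because `p ∤ m`. -/
theorem exists_pow_eq_of_sub_mem_maximalIdeal {k : Type*} [Field k] [Algebra k ℂ_[p]]
    [Algebra ℚ_[p] k] [IsScalarTower ℚ_[p] k ℂ_[p]] [FiniteDimensional ℚ_[p] k] {m : ℕ}
    (hm0 : m ≠ 0) (hm : ¬ p ∣ m) {a t : RingInt p k} (ha : IsUnit a)
    (hat : t ^ m - a ∈ maximalIdeal (RingInt p k)) : ∃ c : RingInt p k, c ^ m = a := by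
  have ht : IsUnit t := by
    by_contra h
    have h1 := sub_mem (Ideal.pow_mem_of_mem _ ((mem_maximalIdeal _).2 h) m
      (Nat.pos_of_ne_zero hm0)) hat
    rw [sub_sub_cancel, mem_maximalIdeal] at h1
    exact h1 ha
  obtain ⟨c, hc, -⟩ := HenselianRing.is_henselian (I := maximalIdeal (RingInt p k))
    (Polynomial.X ^ m - Polynomial.C a) (Polynomial.monic_X_pow_sub_C a hm0) t
    (by simpa using hat)
    (by
      have : Polynomial.eval t (Polynomial.derivative (Polynomial.X ^ m - Polynomial.C a)) =
          (m : RingInt p k) * t ^ (m - 1) := by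
        simp [Polynomial.derivative_X_pow]
      rw [this]
      exact ((RingInt.isUnit_natCast hm).mul (ht.pow _)).map _)
  exact ⟨c, by simpa [Polynomial.IsRoot, sub_eq_zero] using hc⟩

variable {K : IntermediateField ℚ_[p] ℂ_[p]} [FiniteDimensional ℚ_[p] K]

/-- A unit acquires an `m`-th root, `m` prime to `p`, in a finite unramified extension. -/
theorem exists_isUnramifiedExt_pow_eq {m : ℕ} (hm0 : m ≠ 0) (hm : ¬ p ∣ m) {a : RingInt p K}
    (ha : IsUnit a) :
    ∃ L : IntermediateField K ℂ_[p], FiniteDimensional K L ∧ IsUnramifiedExt p K L ∧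
      ∃ c : RingInt p L, c ^ m = RingInt.incl p K L a := by
  -- Adjoin a root of a monic lift of an irreducible factor of `X ^ m - a` over the residue field.
  -- That root is only an approximate `m`-th root of `a`; Hensel's lemma in `L` makes it exact.
  obtain ⟨q, hqm, hqirr, s, hs⟩ := Polynomial.exists_monic_irreducible_factor
    (Polynomial.X ^ m - Polynomial.C (residue (RingInt p K) a)) fun h => by
      have h1 := Polynomial.natDegree_X_pow_sub_C (n := m) (r := residue (RingInt p K) a)
      rw [Polynomial.natDegree_eq_zero_of_isUnit h] at h1
      exact hm0 h1.symm
  obtain ⟨Q, hQq, -, hQ⟩ := Polynomial.lifts_and_degree_eq_and_monic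
    ((Polynomial.mem_lifts q).2 (Polynomial.map_surjective _ residue_surjective q)) hqm
  obtain ⟨s, rfl⟩ := Polynomial.map_surjective _ (residue_surjective (R := RingInt p K)) s
  obtain ⟨θ, hθ⟩ := IsAlgClosed.exists_eval₂_eq_zero_of_injective
    ((algebraMap K ℂ_[p]).comp (RingInt p K).subtype)
    ((algebraMap K ℂ_[p]).injective.comp Subtype.val_injective) Q fun h => by
      rw [hQ.natDegree_eq_zero.1 (Polynomial.natDegree_eq_of_degree_eq_some h), Polynomial.map_one] at hQq
      exact hqirr.not_isUnit (hQq ▸ isUnit_one)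
  have hint : IsIntegral K θ := ⟨Q.map (RingInt p K).subtype, hQ.map _, by
    rw [Polynomial.eval₂_map, ← hθ]⟩
  have hθ1 : θ ∈ 𝓞_ℂ_[p] := by
    have : IsIntegral 𝓞_ℂ_[p] θ := by
      refine ⟨Q.map (RingInt.toComplex p K), hQ.map _, ?_⟩
      rw [Polynomial.eval₂_map, ← hθ]
      rfl
    obtain ⟨y, rfl⟩ := IsIntegrallyClosed.isIntegral_iff.1 this
    exact y.2
  set L := IntermediateField.adjoin K {θ}
  have hfin : FiniteDimensional K L := IntermediateField.adjoin.finiteDimensional hint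
  have hfin' : FiniteDimensional ℚ_[p] L := FiniteDimensional.trans ℚ_[p] K L
  have : IsScalarTower ℚ_[p] L ℂ_[p] := .of_algebraMap_eq fun _ => rfl
  set t : RingInt p L := ⟨IntermediateField.AdjoinSimple.gen K θ, hθ1⟩ with ht
  have htQ : Q.eval₂ (RingInt.incl p K L) t = 0 := by
    refine Subtype.ext (Subtype.ext ?_)
    have := Polynomial.hom_eval₂ Q (RingInt.incl p K L)
      ((algebraMap L ℂ_[p]).comp (RingInt p L).subtype) t
    exact this.trans hθ
  refine ⟨L, hfin, isUnramifiedExt_adjoin_root hQ (hQq ▸ hqirr) htQ fun y => ?_, ?_⟩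
  · have hy : (y : ℂ_[p]) ∈ L.toSubalgebra := y.2
    rw [IntermediateField.adjoin_simple_toSubalgebra_of_isAlgebraic hint.isAlgebraic,
      Algebra.adjoin_singleton_eq_range_aeval] at hy
    obtain ⟨S, hS⟩ := hy
    refine ⟨S, Subtype.ext ?_⟩
    rw [← hS]
    exact (Polynomial.aeval_algebraMap_apply ℂ_[p] (t : L) S).symm
  · refine exists_pow_eq_of_sub_mem_maximalIdeal hm0 hm (t := t) (ha.map _) ?_
    have := eval₂_mem_maximalIdeal_of_map_residue_eq_zero (l := L)
      (D := Polynomial.X ^ m - Polynomial.C a - Q * s) (by simp [hQq, hs]) t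
    simpa [Polynomial.eval₂_mul, htQ] using this

end Unramified

/-! ### The semiconjugate series `f₀` and its properties -/

section Semiconjugacy

variable {p : ℕ} [Fact p.Prime] {k l : Type*} [Field k] [Field l] [Algebra k ℂ_[p]]
  [Algebra l ℂ_[p]] [Algebra k l] [IsScalarTower k l ℂ_[p]]

theorem map_toComplex_map_incl (F : (RingInt p k)⟦X⟧) :
    (F.map (RingInt.incl p k l)).map (RingInt.toComplex p l) = F.map (RingInt.toComplex p k) := by
  ext1 n
  rw [coeff_map, coeff_map, coeff_map, ← RingHom.comp_apply, RingInt.toComplex_comp_incl]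

/-- Away from `0`, the map `z ↦ z ^ m` is unramified, so `F(X ^ m)` vanishes at `z` to the same
order `m` as `F` at `z ^ m`; its `m`-th root `F₀` then vanishes to order one. At `0` the linear
coefficient decides. -/
theorem rootsAreSimple_of_compose_X_pow_eq_pow {F : (RingInt p k)⟦X⟧} {F₀ : (RingInt p l)⟦X⟧}
    {m : ℕ} (hm : m ≠ 0) (hF : NonzeroRootsHaveMult F m) (hF₀ : constantCoeff F₀ = 0)
    (hd : F₀.derivZero ≠ 0) (h : (F.map (RingInt.incl p k l)).compose (X ^ m) = F₀ ^ m) :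
    RootsAreSimple F₀ := by
  intro z hz
  rw [← Nat.cast_one, rootMult_eq_iff]
  simp only [pow_one]
  rw [evalDisk_eq_zero_iff] at hz
  by_cases hz0 : z = 0
  · subst hz0
    obtain ⟨q, rfl, hq⟩ := eq_X_mul hF₀
    refine ⟨q.map (RingInt.toComplex p l), by simp, fun h0 => hd ?_⟩
    obtain ⟨a, ha⟩ := exists_diskEval_eq (0 : maximalIdeal 𝓞_ℂ_[p])
      (q.map (RingInt.toComplex p l))
    rw [h0, ZeroMemClass.coe_zero, zero_mul, add_zero, constantCoeff_map_apply, hq] at ha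
    exact RingInt.toComplex_injective (ha.symm.trans (map_zero _).symm)
  have hz0' : (z : 𝓞_ℂ_[p]) ≠ 0 := fun h0 => hz0 (Subtype.ext h0)
  have hXm : constantCoeff (X ^ m : 𝓞_ℂ_[p]⟦X⟧) = 0 := by simp [hm]
  have hC : (F.map (RingInt.toComplex p k)).compose (X ^ m) =
      F₀.map (RingInt.toComplex p l) ^ m := by
    rw [← map_pow, ← h, map_compose (by simp [hm]), map_toComplex_map_incl, map_pow, map_X]
  set a : maximalIdeal 𝓞_ℂ_[p] := ⟨_, diskEval_mem_maximalIdeal z hXm⟩ with ha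
  have ha' : (a : 𝓞_ℂ_[p]) = (z : 𝓞_ℂ_[p]) ^ m := by rw [ha]; simp
  have hFa : diskEval a (F.map (RingInt.toComplex p k)) = 0 := by
    rw [ha, ← diskEval_compose z hXm, hC, map_pow, hz, zero_pow hm]
  obtain ⟨q, hq, hqa⟩ := (rootMult_eq_iff _ _ _).1 (hF a
    (fun h0 => pow_ne_zero m hz0' (ha'.symm.trans (congrArg Subtype.val h0)))
    ((evalDisk_eq_zero_iff _ _).2 hFa))
  obtain ⟨r, hr⟩ : X - C (z : 𝓞_ℂ_[p]) ∣ X ^ m - C (a : 𝓞_ℂ_[p]) := by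
    rw [X_sub_C_dvd_iff]; simp [ha']
  have hrz : diskEval z r ≠ 0 := by
    rw [← diskEval_derivative_X_sub_C_mul, ← hr]
    have h2 : (m : 𝓞_ℂ_[p]) ≠ 0 := fun h0 => hm (by
      have h5 : (m : ℂ_[p]) = 0 := by simpa using congrArg Subtype.val h0
      exact_mod_cast h5)
    simp [Derivation.leibniz_pow, derivative_C, hz0, h2]
  obtain ⟨s, hs⟩ := (X_sub_C_dvd_iff z _).2 hz
  refine ⟨s, hs, fun hs0 => ?_⟩
  have hpow : s ^ m = r ^ m * q.compose (X ^ m) := by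
    refine mul_left_cancel₀ (pow_ne_zero m (X_sub_C_ne_zero (z : 𝓞_ℂ_[p]))) ?_
    rw [← mul_pow, ← hs, ← hC, hq, compose_mul hXm, compose_pow hXm, compose_sub hXm,
      X_compose hXm, C_compose, hr, mul_pow, mul_assoc]
  have := congrArg (diskEval z) hpow
  rw [map_pow, hs0, zero_pow hm, map_mul, map_pow, diskEval_compose z hXm] at this
  exact mul_ne_zero (pow_ne_zero m hrz) hqa this.symm

theorem map_mem_commInvertible {R S : Type*} [CommRing R] [CommRing S] (φ : R →+* S)
    {f u : R⟦X⟧} (hf : constantCoeff f = 0) (hu : u ∈ f.commInvertible) :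
    u.map φ ∈ (f.map φ).commInvertible := by
  obtain ⟨hu0, hu1, hu2⟩ := hu
  exact ⟨by rw [constantCoeff_map_apply, hu0, map_zero], by rw [derivZero_map]; exact hu1.map φ,
    by rw [← map_compose hu0, hu2, map_compose hf]⟩

/-- The units of `F` that are linear coefficients of invertible series commuting with `f`. -/
noncomputable def derivsSubgroup (F : Type*) [Field F] [Algebra F ℂ_[p]] [Algebra F k]
    [IsScalarTower F k ℂ_[p]] {f : (RingInt p k)⟦X⟧} (hf : constantCoeff f = 0) :
    Subgroup (RingInt p F)ˣ where
  carrier := {a | ∃ u ∈ f.commInvertible, u.derivZero = RingInt.incl p F k a}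
  mul_mem' := by
    rintro a b ⟨u, hu, hua⟩ ⟨v, hv, hvb⟩
    exact ⟨_, commInvertible_compose hf hu hv, by
      rw [derivZero_compose hu.1 hv.1, hua, hvb, Units.val_mul, map_mul]⟩
  one_mem' := ⟨X, X_mem_commInvertible hf, by rw [derivZero_X, Units.val_one, map_one]⟩
  inv_mem' := by
    rintro a ⟨u, hu, hua⟩
    obtain ⟨v, hv, huv⟩ := exists_inverse_mem_commInvertible hf hu
    refine ⟨v, hv, hu.2.1.mul_left_cancel ?_⟩
    rw [huv, hua, ← map_mul, Units.mul_inv, map_one]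

/-- If `a ∈ H` then `a ^ m ∈ H` is the linear coefficient of some `u`, and `a` itself is an
admissible `m`-th root for lifting `u`. So the group attached to `f₀` contains the open subgroup
`H`. -/
theorem isOpenSubgroupDerivs_of_lift (F : Type*) [Field F] [TopologicalSpace F]
    [IsTopologicalRing F] [Algebra F ℂ_[p]] [Algebra F k] [Algebra F l] [IsScalarTower F k ℂ_[p]]
    [IsScalarTower F l ℂ_[p]] {f : (RingInt p k)⟦X⟧} {f₀ : (RingInt p l)⟦X⟧}
    (hf₀ : constantCoeff f₀ = 0) {m : ℕ}
    (hlift : ∀ u ∈ f.commInvertible, ∀ c : RingInt p l,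
      c ^ m = RingInt.incl p k l u.derivZero → ∃ u₀ ∈ f₀.commInvertible, u₀.derivZero = c)
    (h : IsOpenSubgroupDerivs F f) : IsOpenSubgroupDerivs F f₀ := by
  have : ContinuousMul (RingInt p F) := inferInstanceAs (ContinuousMul (RingInt p F).toSubring)
  obtain ⟨H, hopen, hH⟩ := h
  refine ⟨derivsSubgroup F hf₀, Subgroup.isOpen_mono (H₁ := H) (fun a ha => ?_) hopen,
    fun a => Iff.rfl⟩
  obtain ⟨u, hu, hua⟩ := (hH _).1 (H.pow_mem ha m)
  refine hlift u hu _ ?_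
  rw [hua, RingInt.incl_incl, ← map_pow, Units.val_pow_eq_pow_val]

/-- The series `f₀` with `f(X ^ m) = f₀(X) ^ m`. -/
theorem exists_compose_X_pow_eq_pow {f : (RingInt p k)⟦X⟧} (hf : f.IsNoninvertibleStable)
    {m : ℕ} (hm0 : m ≠ 0) (hpm : ¬ p ∣ m)
    (hroots : ∀ n : ℕ, 1 ≤ n → NonzeroRootsHaveMult (f.compIter n) m)
    {P v : (RingInt p k)⟦X⟧} (hv : IsUnit v) (hfP : f = X * P ^ m * v) {c : RingInt p l}
    (hc : c ^ m = RingInt.incl p k l (constantCoeff v)) :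
    ∃ f₀ : (RingInt p l)⟦X⟧, f₀.IsNoninvertibleStable ∧
      (f.map (RingInt.incl p k l)).compose (X ^ m) = f₀ ^ m ∧
      f₀.derivZero ^ m = RingInt.incl p k l f.derivZero ∧
      (∀ n : ℕ, 1 ≤ n → RootsAreSimple (f₀.compIter n)) ∧
      ∀ u ∈ f.commInvertible, ∀ a : RingInt p l, a ^ m = RingInt.incl p k l u.derivZero →
        ∃ u₀ ∈ f₀.commInvertible,
          (u.map (RingInt.incl p k l)).compose (X ^ m) = u₀ ^ m ∧ u₀.derivZero = a := by
  have hf0 := hf.constantCoeff_eq_zero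
  obtain ⟨i, hi⟩ : ∃ i, i = RingInt.incl p k l := ⟨_, rfl⟩
  rw [← hi] at hc ⊢
  have hinj : Function.Injective i := hi ▸ RingInt.incl_injective
  have hmL : IsUnit (m : RingInt p l) := RingInt.isUnit_natCast hpm
  have hcu : IsUnit c :=
    (isUnit_pow_iff hm0).1 (hc ▸ (isUnit_iff_constantCoeff.1 hv).map i)
  obtain ⟨w, hw, hw0⟩ := exists_pow_eq hm0 hmL (t := v.map i) hcu
    (by rw [hc, constantCoeff_map_apply])
  have hXm : constantCoeff (X ^ m : (RingInt p l)⟦X⟧) = 0 := by simp [hm0]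
  obtain ⟨f₀, hf₀⟩ : ∃ f₀ : (RingInt p l)⟦X⟧, f₀ = X * (P.map i * w).compose (X ^ m) := ⟨_, rfl⟩
  have hf₀0 : constantCoeff f₀ = 0 := by rw [hf₀]; simp
  have hpow : (f.map i).compose (X ^ m) = f₀ ^ m := by
    have : f.map i = X * (P.map i * w) ^ m := by
      rw [hfP, mul_pow, hw]
      simp [mul_assoc]
    rw [this, hf₀, compose_mul hXm, X_compose hXm, compose_pow hXm, mul_pow]
  have hder : f₀.derivZero ^ m = i f.derivZero := by
    rw [hf₀, derivZero_X_mul, constantCoeff_compose hXm, map_mul, mul_pow, hw0, hc,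
      constantCoeff_map_apply, hfP, mul_assoc, derivZero_X_mul]
    simp
  have hder0 : f₀.derivZero ≠ 0 := fun h => by
    rw [h, zero_pow hm0] at hder
    exact hf.stable.1 (hinj (hder.symm.trans (map_zero i).symm))
  have hfi0 : constantCoeff (f.map i) = 0 := by rw [constantCoeff_map_apply, hf0, map_zero]
  refine ⟨f₀, ⟨hf₀0, ?_, ⟨hder0, fun n hn h => ?_⟩, fun h => ?_⟩, hpow, hder, fun n hn => ?_,
    fun u hu a ha => exists_commInvertible_lift hm0 hmL hfi0 hf₀0 hder0 hpow
      (map_mem_commInvertible i hf0 hu) (by rw [ha, derivZero_map])⟩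
  · refine Ideal.IsPrime.mem_of_pow_mem inferInstance m ?_
    rw [hder]
    rw [hi]
    exact (RingInt.incl_mem_maximalIdeal_iff _).2 hf.noninvertible
  · refine hf.stable.2 n hn (hinj ?_)
    rw [map_pow, ← hder, ← pow_mul, mul_comm, pow_mul, h, one_pow, map_one]
  -- If `f₀` reduced to zero, so would `f(X ^ m)`, whose coefficient of index `m * n` is the `n`-th
  -- coefficient of `f`.
  · refine hf.map_residue_ne_zero ?_
    have h1 : ((f.map i).map (residue (RingInt p l))).compose (X ^ m) = 0 := by
      have := congrArg (PowerSeries.map (residue (RingInt p l))) hpow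
      rw [map_pow, h, zero_pow hm0, map_compose hXm, map_pow, map_X] at this
      exact this
    ext1 n
    have h2 := congrArg (coeff (m * n)) h1
    rw [compose, coeff_subst_X_pow hm0, if_pos (dvd_mul_right m n),
      Nat.mul_div_cancel_left n (Nat.pos_of_ne_zero hm0), map_zero, coeff_map, coeff_map] at h2
    rw [coeff_map, map_zero, residue_eq_zero_iff, ← RingInt.incl_mem_maximalIdeal_iff (l := l),
      ← residue_eq_zero_iff, ← hi]
    exact h2
  · refine rootsAreSimple_of_compose_X_pow_eq_pow hm0 (hroots n hn)
      (constantCoeff_compIter hf₀0 n) ?_ ?_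
    · rw [derivZero_compIter hf₀0]
      exact pow_ne_zero n hder0
    · rw [← hi, map_compIter hf0, compIter_compose hfi0 hf₀0 hXm
        (by rw [hpow, X_pow_compose hf₀0]), X_pow_compose (constantCoeff_compIter hf₀0 n)]

end Semiconjugacy

/-! ### The main theorem -/

set_option maxHeartbeats 1000000 in
theorem theoremB (p : ℕ) [Fact p.Prime]
    (K : IntermediateField ℚ_[p] ℂ_[p]) [FiniteDimensional ℚ_[p] K]
    (f : (RingInt p K)⟦X⟧) (hf : f.IsNoninvertibleStable)
    (m : ℕ) (hm : 2 ≤ m)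
    (hroots : ∀ n : ℕ, 1 ≤ n → NonzeroRootsHaveMult (f.compIter n) m)
    (hcomm : ¬ p ∣ m ∨ ∃ u ∈ f.commInvertible, u.IsStable) :
    ∃ L : IntermediateField K ℂ_[p], FiniteDimensional K L ∧ IsUnramifiedExt p K L ∧
      ∃ f₀ : (RingInt p L)⟦X⟧, f₀.IsNoninvertibleStable ∧
        (f.map (RingInt.incl p K L)).compose (X ^ m) = (X ^ m : (RingInt p L)⟦X⟧).compose f₀ ∧
        (∀ n : ℕ, 1 ≤ n → RootsAreSimple (f₀.compIter n)) ∧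
        (∀ u ∈ f.commInvertible, u.derivZero - 1 ∈ maximalIdeal (RingInt p K) →
          ∃ u₀ ∈ f₀.commInvertible,
            (u.map (RingInt.incl p K L)).compose (X ^ m) =
              (X ^ m : (RingInt p L)⟦X⟧).compose u₀) ∧
        (∀ F : Subfield K,
          (∃ a ∈ maximalIdeal (RingInt p F), RingInt.incl p F K a = f.derivZero) →
          IsOpenSubgroupDerivs F f →
            (∃ a ∈ maximalIdeal (RingInt p F),
              RingInt.incl p F L a = (f₀.compIter m).derivZero) ∧
            IsOpenSubgroupDerivs F f₀) := by
  have hm0 : m ≠ 0 := by omega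
  have hpm : ¬ p ∣ m := by
    rcases hcomm with h | ⟨u, hu, hustab⟩
    · exact h
    · exact not_dvd_of_commInvertible_stable hf hm0 hroots hu hustab
  have hroots1 : NonzeroRootsHaveMult f m := by
    have := hroots 1 le_rfl
    rwa [compIter, compIter, compose_X] at this
  obtain ⟨P, v, hv, hfP⟩ := exists_eq_X_mul_pow_mul_unit hf hm0 hroots1
  obtain ⟨L, hL, hLK, c, hc⟩ := exists_isUnramifiedExt_pow_eq hm0 hpm
    (isUnit_iff_constantCoeff.1 hv)
  obtain ⟨f₀, hf₀, hpow, hder, hsimple, hlift⟩ :=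
    exists_compose_X_pow_eq_pow hf hm0 hpm hroots hv hfP hc
  have hf₀0 := hf₀.constantCoeff_eq_zero
  refine ⟨L, hL, hLK, f₀, hf₀, ?_, hsimple, fun u hu hu1 => ?_,
    fun F ⟨a, ha, haf⟩ hF => ⟨⟨a, ha, ?_⟩, ?_⟩⟩
  · rw [hpow, X_pow_compose hf₀0]
  -- Since `u'(0) ≡ 1`, Hensel's lemma starting from `1` finds the required `m`-th root already in
  -- the ring of integers of `K`.
  · obtain ⟨b, hb⟩ := exists_pow_eq_of_sub_mem_maximalIdeal hm0 hpm (t := 1) hu.2.1 (by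
      rw [one_pow, ← neg_sub]
      exact neg_mem hu1)
    obtain ⟨u₀, hu₀, hu₀m, -⟩ := hlift u hu (RingInt.incl p K L b) (by rw [← map_pow, hb])
    exact ⟨u₀, hu₀, by rw [hu₀m, X_pow_compose hu₀.1]⟩
  -- The linear coefficient of the `m`-th iterate is `f₀'(0) ^ m = f'(0)`, so the same `a` serves as
  -- witness.
  · rw [derivZero_compIter hf₀0, hder, ← haf, RingInt.incl_incl]
  · refine isOpenSubgroupDerivs_of_lift F hf₀0 (m := m) (fun u hu a ha => ?_) hF
    obtain ⟨u₀, hu₀, -, hu₀a⟩ := hlift u hu a ha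
    exact ⟨u₀, hu₀, hu₀a⟩
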